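/- Let $q$ be a prime power, $k\ge 1$, $\delta\ge 0$ integers with $(k,\delta)\neq(1,0)$, $\mu=\lceil\delta/k\rceil$ and $n=\frac{q^{\delta}(q^k-1)}{q-1}$. Let $M\in\mathbb F_q^{(k+\delta)\times n}$ be a generator matrix of a MacDonald code whose columns, in any order, are exactly the vectors of $\mathbb F_q^{k+\delta}$ whose first nonzero entry is $1$ and stands among the first $k$ entries. Let $G(z)=\sum_{i=0}^{\mu}G_iz^i\in\mathbb F_q[z]^{k\times n}$ be the generator matrix of the convolutional code of Construction 1: cut from top to bottom, $M$ consists of $G_0,\dots,G_{\mu-1}$ ($k$ rows each) and of the remaining $\delta+k-k\mu$ rows, which are, in order, the rows of $G_\mu$ in some chosen positions, the other rows of $G_\mu$ being zero. Let $N\ge 2\mu+1$, and let $r(z)=\sum_{t=0}^{N-1}r_tz^t\in\mathbb F_q[z]^n$ be received. The Viterbi algorithm runs through the times $t=1,\dots,N$ of the trellis with states $(u_{t-1},\dots,\tilde u_{t-\mu})\in\mathbb F_q^{\delta}$ (where $\tilde u$ consists of the components of $u$ that belong to the chosen rows of $G_\mu$ and $u_{N-\mu}=\dots=u_{N-1}=0$).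 At each time it computes the distances of $r_{t-1}$ to the labels $c_{t-1}$ of all branches, adds them to the metrics of the survivors at time $t-1$, and for each state keeps a path with the smallest metric, ties being broken arbitrarily. The general algorithm computes each distance symbol by symbol. The improved algorithm splits the positions of $r_{t-1}$ into blocks on which the labels run through first-order Reed--Muller codes $\mathcal R(q,m)$ (with or without the all-one row); for each block it computes the numbers of agreements with all codewords as $B_z\star S_w$. Here $w$ is the received block and $S_w=(s^{(x)})_{x\in\mathbb F_q^m}$ has as entries the indicator vectors $s^{(x)}\in\mathbb R^{q}$ of the symbols $w_x$; the rows and columns of $B_z$ are indexed by $\mathbb F_q^m$ and $(B_z)_{b,x}=z^{\langle b,x\rangle}$, where $z^c$ acts on $\mathbb R^q$, with coordinates indexed by $\mathbb F_q$, by $(z^c\star s)_a=s_{a+c}$. It uses the factorization $B_z=((H\otimes I\otimes\cdots\otimes I)P)^m$ with $H=(z^{ab})_{a,b\in\mathbb F_q}$ and $P$ the permutation matrix of the perfect shuffle. It then adds these numbers over the blocks and subtracts the sum from $n$. Operations counted are additions and subtractions of integers, comparisons of integers and comparisons of symbols; storage, look-up and arithmetic in $\mathbb F_q$ are not counted. Then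 both algorithms return a message $\hat u(z)\in\mathbb F_q[z]^k$ with $\deg \hat u\le N-1-\mu$ for which the Hamming distance of $\hat u(z)G(z)$ to $r(z)$ is smallest among all messages of degree at most $N-1-\mu$, together with this distance. The improved algorithm needs $$O\bigl(N\cdot q^2\cdot n\cdot\log_q n\bigr)$$ operations, and the general algorithm needs $\Theta\bigl((N-2\mu+2)\,q\,n^2\bigr)$ operations, hence $\Theta(N\,q\,n^2)$ if $N\ge 3\mu$. All implied constants are absolute. -/

import Mathlib

open Polynomial

universe u v w x

namespace Viterbi

/-! ## Programs with counted operations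

A program manipulates metrics, which are values of an abstract type `V` that it can only add,
subtract and compare, and symbols of the alphabet `F`, which it can test for equality. Each of
these operations counts as one. Storing and looking up values, and the arithmetic of the encoder
in `F` (which codeword belongs to which branch), are not counted. -/

inductive Prog (F : Type u) (V : Type) (α : Type v) : Type (max u v)
  | ret (a : α) : Prog F V α
  | add (a b : V) (next : V → Prog F V α) : Prog F V α
  | sub (a b : V) (next : V → Prog F V α) : Prog F V α
  | le (a b : V) (next : Bool → Prog F V α) : Prog F V α
  | eqSym (a b : F) (next : Bool → Prog F V α) : Prog F V α

namespace Prog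

variable {F : Type u} {V : Type} {α : Type v} {β : Type w} {ι : Type x}

/-- Sequential composition. -/
def bind : Prog F V α → (α → Prog F V β) → Prog F V β
  | ret a, f => f a
  | add a b next, f => add a b fun c => (next c).bind f
  | sub a b next, f => sub a b fun c => (next c).bind f
  | le a b next, f => le a b fun c => (next c).bind f
  | eqSym a b next, f => eqSym a b fun c => (next c).bind f

/-- The result of a program when the metrics are integers. -/
def result [DecidableEq F] : Prog F ℤ α → α
  | ret a => a
  | add a b next => (next (a + b)).result
  | sub a b next => (next (a - b)).result
  | le a b next => (next (decide (a ≤ b))).result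
  | eqSym a b next => (next (decide (a = b))).result

/-- The number of operations (additions and subtractions of integers, comparisons of integers,
comparisons of symbols) that a program performs when the metrics are integers. -/
def ops [DecidableEq F] : Prog F ℤ α → ℕ
  | ret _ => 0
  | add a b next => (next (a + b)).ops + 1
  | sub a b next => (next (a - b)).ops + 1
  | le a b next => (next (decide (a ≤ b))).ops + 1
  | eqSym a b next => (next (decide (a = b))).ops + 1

/-- Run `f 0, …, f (n - 1)` one after the other and store the results in a table. -/
def tabulateFin : (n : ℕ) → (Fin n → Prog F V β) → Prog F V (Fin n → β)
  | 0, _ => ret Fin.elim0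
  | n + 1, f => (f 0).bind fun b =>
      (tabulateFin n fun i => f i.succ).bind fun g => ret (Fin.cons b g)

/-- Run `f i` for every index `i` and store the results in a table. -/
noncomputable def tabulate [Fintype ι] (f : ι → Prog F V β) : Prog F V (ι → β) :=
  (tabulateFin (Fintype.card ι) fun i => f ((Fintype.equivFin ι).symm i)).bind fun g =>
    ret fun i => g (Fintype.equivFin ι i)

/-- Add the entries of a list to a running sum. -/
def sumFrom : V → List V → Prog F V V
  | a, [] => ret a
  | a, b :: l => add a b fun c => sumFrom c l

/-- The sum of a list, with one addition less than the list has entries. -/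
def sum (zero : V) : List V → Prog F V V
  | [] => ret zero
  | a :: l => sumFrom a l

end Prog

/-! ## Vectors -/

section Vectors

variable {F : Type u} [Field F]

/-- The entry of a vector at a position given by a natural number (`0` beyond the end). -/
def entry {l : ℕ} (y : Fin l → F) (i : ℕ) : F := if h : i < l then y ⟨i, h⟩ else 0

/-- The entries of a vector at the positions `start, …, start + len - 1`. -/
def slice {l : ℕ} (y : Fin l → F) (start len : ℕ) : Fin len → F := fun j => entry y (start + j)

/-- The first nonzero entry of `y` is a `1`, and it is among the first `k` entries. -/
def IsNormalized (k : ℕ) {l : ℕ} (y : Fin l → F) : Prop :=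
  ∃ i : Fin l, (i : ℕ) < k ∧ y i = 1 ∧ ∀ j < i, y j = 0

instance [DecidableEq F] (k l : ℕ) : DecidablePred (IsNormalized (F := F) k (l := l)) :=
  fun y => inferInstanceAs (Decidable (∃ i : Fin l, (i : ℕ) < k ∧ y i = 1 ∧ ∀ j < i, y j = 0))

end Vectors

/-! ## The convolutional codes -/

section Code

variable {F : Type u} [Field F] {k δ n : ℕ}

/-- The columns of the generator matrices of the MacDonald code of dimension `k + δ`: the
normalized representatives of the one-dimensional subspaces of `F ^ (k + δ)` on which the first `k`
coordinates do not all vanish. -/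
abbrev MacDonaldColumn (F : Type u) [Field F] (k δ : ℕ) : Type u :=
  {y : Fin (k + δ) → F // IsNormalized k y}

/-- The generator matrix of the MacDonald code with its columns in the order `col`. -/
def macDonaldMatrix (col : Fin n ≃ MacDonaldColumn F k δ) : Matrix (Fin (k + δ)) (Fin n) F :=
  Matrix.of fun ρ c => (col c).1 ρ

/-- The memory `⌈δ / k⌉`. -/
def memory (k δ : ℕ) : ℕ := δ ⌈/⌉ k

/-- The number `δ + k - k ⌈δ / k⌉` of nonzero rows of the last coefficient matrix. -/
abbrev numLast (k δ : ℕ) : ℕ := δ + k - memory k δ * k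

/-- Row `ρ` of the stacked matrix `(G₀; G₁; …; G̃_μ)` is a row of the coefficient matrix with the
index `lag ρ`. -/
def lag (ρ : Fin (k + δ)) : ℕ := if (ρ : ℕ) < memory k δ * k then ρ / k else memory k δ

/-- The row of the coefficient matrix `G_(lag ρ)` that row `ρ` of the stacked matrix is; `e` tells
which rows of the last coefficient matrix `G_μ` are the rows of `G̃_μ` (the others are zero). -/
def component (e : Fin (numLast k δ) ↪o Fin k) (ρ : Fin (k + δ)) : Fin k :=
  if h : (ρ : ℕ) < memory k δ * k then
    ⟨ρ % k, Nat.mod_lt _ (Nat.pos_of_ne_zero fun h0 => by simp [h0] at h)⟩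
  else e ⟨ρ - memory k δ * k, by have := ρ.2; simp only [numLast]; omega⟩

/-- The coefficient matrix `G_i` of the generator matrix with the stacked matrix `M`. -/
def coeffMatrix (M : Matrix (Fin (k + δ)) (Fin n) F) (e : Fin (numLast k δ) ↪o Fin k) (i : ℕ) :
    Matrix (Fin k) (Fin n) F :=
  Matrix.of fun a c => ∑ ρ, if lag ρ = i ∧ component e ρ = a then M ρ c else 0

/-- The polynomial generator matrix `G(z) = G₀ + G₁ z + ⋯ + G_μ z ^ μ`. -/
noncomputable def genMatrix (M : Matrix (Fin (k + δ)) (Fin n) F)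
    (e : Fin (numLast k δ) ↪o Fin k) : Matrix (Fin k) (Fin n) F[X] :=
  Matrix.of fun a c => ∑ i ∈ Finset.range (memory k δ + 1), monomial i (coeffMatrix M e i a c)

/-- The coefficient vector at `z ^ t` of a polynomial vector. -/
def coeffVec (p : Fin n → F[X]) (t : ℕ) : Fin n → F := fun c => (p c).coeff t

/-- The Hamming distance of the sequences of the first `N` coefficient vectors. -/
def seqDist [DecidableEq F] (N : ℕ) (p r : Fin n → F[X]) : ℕ :=
  ∑ t ∈ Finset.range N, hammingDist (coeffVec p t) (coeffVec r t)

/-- `out` consists of a message of degree at most `N - 1 - μ` whose codeword is closest to the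
received word `r` among the codewords of all such messages, and of the distance of this codeword
to `r`. -/
def IsNearestMessage [DecidableEq F] (M : Matrix (Fin (k + δ)) (Fin n) F)
    (e : Fin (numLast k δ) ↪o Fin k) (N : ℕ) (r : Fin n → F[X]) (out : (Fin k → F[X]) × ℤ) : Prop :=
  (∀ a, (out.1 a).degree < ((N - memory k δ : ℕ) : WithBot ℕ)) ∧
  out.2 = seqDist N (Matrix.vecMul out.1 (genMatrix M e)) r ∧
  ∀ m : Fin k → F[X], (∀ a, (m a).degree < ((N - memory k δ : ℕ) : WithBot ℕ)) →
    seqDist N (Matrix.vecMul out.1 (genMatrix M e)) r ≤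
      seqDist N (Matrix.vecMul m (genMatrix M e)) r

end Code

/-! ## The trellis

A branch of the trellis from time `t - 1` to time `t` is given by the vector
`y = (u_(t-1), u_(t-2), …, ũ_(t-1-μ))` in `F ^ (k + δ)`: the input `u_(t-1)`, followed by the state
at time `t - 1`. Its label is the codeword `y M` of the block code generated by the stacked
matrix `M`. -/

section Trellis

variable {F : Type u} [Field F] {k δ : ℕ}

/-- The state in which a branch starts. -/
def startState (y : Fin (k + δ) → F) : Fin δ → F := fun j => y (Fin.natAdd k j)

/-- The state `(u_(t-1), …, ũ_(t-μ))` in which a branch ends: what had lag `l - 1` gets lag `l`. -/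
def endState (e : Fin (numLast k δ) ↪o Fin k) (y : Fin (k + δ) → F) : Fin δ → F :=
  fun j => entry y ((lag (Fin.natAdd k j) - 1) * k + component e (Fin.natAdd k j))

/-- The branches into time `t` that occur in the trellis of length `N`: inputs at negative times
and inputs at the times `N - μ, …, N - 1` are zero. -/
def IsBranch (N t : ℕ) (y : Fin (k + δ) → F) : Prop :=
  ∀ ρ : Fin (k + δ), t * k ≤ ρ ∨ (ρ : ℕ) < (t + memory k δ - N) * k → y ρ = 0

instance [DecidableEq F] (N t : ℕ) : DecidablePred (IsBranch (F := F) (k := k) (δ := δ) N t) :=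
  fun y => inferInstanceAs (Decidable (∀ ρ : Fin (k + δ),
    t * k ≤ ρ ∨ (ρ : ℕ) < (t + memory k δ - N) * k → y ρ = 0))

end Trellis

/-! ## The Viterbi algorithm for given branch metrics -/

section Algorithm

variable {F : Type u} [Field F] [Fintype F] [DecidableEq F] {V : Type} {k δ : ℕ}

/-- For each branch in a list, add its branch metric to the metric of the survivor in the state
where the branch starts. -/
def addMetrics (metric : (Fin δ → F) → V) (d : (Fin (k + δ) → F) → V) :
    List (Fin (k + δ) → F) → Prog F V (List (V × (Fin (k + δ) → F)))
  | [] => .ret []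
  | y :: l => .add (metric (startState y)) (d y) fun c =>
      (addMetrics metric d l).bind fun l' => .ret ((c, y) :: l')

/-- Select a branch with the smallest metric; `coin` decides in the case of ties. -/
def select (coin : (Fin (k + δ) → F) → Bool) :
    V × (Fin (k + δ) → F) → List (V × (Fin (k + δ) → F)) → Prog F V (V × (Fin (k + δ) → F))
  | best, [] => .ret best
  | best, c :: l =>
    match coin c.2 with
    | true => .le c.1 best.1 fun b => select coin (bif b then c else best) l
    | false => .le best.1 c.1 fun b => select coin (bif b then best else c) l

/-- One step of the algorithm: from the survivors at time `t - 1` (metric and path, for each state;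
entries of states that are not reached are never used) and the branch metrics `d` of the branches
into time `t` to the survivors at time `t`. The path is the polynomial of the inputs so far. -/
noncomputable def trellisStep (lit : ℕ → V) (e : Fin (numLast k δ) ↪o Fin k) (N : ℕ)
    (coin : ℕ → (Fin (k + δ) → F) → Bool) (t : ℕ)
    (surv : (Fin δ → F) → V × (Fin k → F[X])) (d : (Fin (k + δ) → F) → V) :
    Prog F V ((Fin δ → F) → V × (Fin k → F[X])) :=
  .tabulate fun s =>
    (addMetrics (fun s' => (surv s').1) d
        ({y | IsBranch N t y ∧ endState e y = s} : Finset (Fin (k + δ) → F)).toList).bind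
      fun l => match l with
        | [] => .ret (lit 0, 0)
        | c :: l => (select (coin t) c l).bind fun best =>
            .ret (best.1, fun a =>
              (surv (startState best.2)).2 a + monomial (t - 1) (best.2 (Fin.castAdd δ a)))

/-- The survivors at time `t`, where the program `branchMetrics t` computes the branch metrics
of the branches into time `t`. -/
noncomputable def survivors (lit : ℕ → V) (e : Fin (numLast k δ) ↪o Fin k) (N : ℕ)
    (coin : ℕ → (Fin (k + δ) → F) → Bool)
    (branchMetrics : ℕ → Prog F V ((Fin (k + δ) → F) → V)) :
    ℕ → Prog F V ((Fin δ → F) → V × (Fin k → F[X]))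
  | 0 => .ret fun _ => (lit 0, 0)
  | t + 1 => (survivors lit e N coin branchMetrics t).bind fun surv =>
      (branchMetrics (t + 1)).bind fun d => trellisStep lit e N coin (t + 1) surv d

/-- The single survivor path and its metric at time `N`. -/
noncomputable def trellisSearch (lit : ℕ → V) (e : Fin (numLast k δ) ↪o Fin k) (N : ℕ)
    (coin : ℕ → (Fin (k + δ) → F) → Bool)
    (branchMetrics : ℕ → Prog F V ((Fin (k + δ) → F) → V)) : Prog F V ((Fin k → F[X]) × V) :=
  (survivors lit e N coin branchMetrics N).bind fun surv => .ret ((surv 0).2, (surv 0).1)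

end Algorithm

/-! ## The general Viterbi algorithm -/

section General

variable {F : Type u} [Field F] [Fintype F] [DecidableEq F] {V : Type} {k δ n : ℕ}

/-- The distance of two words, computed symbol by symbol. -/
noncomputable def directDistance (lit : ℕ → V) (c r : Fin n → F) : Prog F V V :=
  (Prog.tabulate fun i => .eqSym (c i) (r i) fun b => .ret (bif b then lit 0 else lit 1)).bind
    fun s => .sum (lit 0) ((Finset.univ : Finset (Fin n)).toList.map s)

/-- The branch metrics of all branches into time `t`, one after the other. -/
noncomputable def directMetrics (lit : ℕ → V) (M : Matrix (Fin (k + δ)) (Fin n) F) (N t : ℕ)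
    (r : Fin n → F) : Prog F V ((Fin (k + δ) → F) → V) :=
  (Prog.tabulate fun y : {y : Fin (k + δ) → F // IsBranch N t y} =>
      directDistance lit (Matrix.vecMul y.1 M) r).bind
    fun d => .ret fun y => if h : IsBranch N t y then d ⟨y, h⟩ else lit 0

/-- The general Viterbi algorithm. -/
noncomputable def generalViterbi (lit : ℕ → V) (M : Matrix (Fin (k + δ)) (Fin n) F)
    (e : Fin (numLast k δ) ↪o Fin k) (N : ℕ) (coin : ℕ → (Fin (k + δ) → F) → Bool)
    (r : Fin n → F[X]) : Prog F V ((Fin k → F[X]) × V) :=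
  trellisSearch lit e N coin fun t => directMetrics lit M N t (coeffVec r (t - 1))

end General

/-! ## Fast correlation decoding of first order Reed–Muller codes

Positions of a word of length `q ^ m` and rows of `B_z` are indexed by the digits of their `q`-ary
expansions, i.e. by `Fin m → F` (least significant digit first); the entries of a vector in `ℝ ^ q`
are indexed by `F`. Thus `(z ^ c ⋆ s) a = s (a + c)`. -/

section ReedMuller

variable {F : Type u} [Field F] [Fintype F] [DecidableEq F] {V : Type}

/-- The table `S_w` of the indicator vectors of the symbols of `w`. -/
noncomputable def indicatorTable (lit : ℕ → V) {m : ℕ} (w : (Fin m → F) → F) :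
    Prog F V ((Fin m → F) → F → V) :=
  (Prog.tabulate fun p : (Fin m → F) × F =>
      .eqSym (w p.1) p.2 fun b => .ret (bif b then lit 1 else lit 0)).bind
    fun s => .ret fun i a => s (i, a)

/-- The action of the permutation matrix `P` of the perfect shuffle of `q ^ m * q` cards, which
moves the most significant digit of the index to the least significant place. -/
def shuffle {m : ℕ} (D : (Fin (m + 1) → F) → F → V) : (Fin (m + 1) → F) → F → V :=
  fun i => D (i ∘ (finRotate (m + 1)).symm)

/-- The action of the sparse matrix `H ⊗ I ⊗ ⋯ ⊗ I`, where `H_(b,x) = z ^ (b x)`: the factor `H`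
acts on the most significant digit. -/
noncomputable def sparseStep (lit : ℕ → V) {m : ℕ} (D : (Fin (m + 1) → F) → F → V) :
    Prog F V ((Fin (m + 1) → F) → F → V) :=
  (Prog.tabulate fun p : (Fin (m + 1) → F) × F =>
      Prog.sum (lit 0) ((Finset.univ : Finset F).toList.map fun x =>
        D (Function.update p.1 (Fin.last m) x) (p.2 + p.1 (Fin.last m) * x))).bind
    fun s => .ret fun i a => s (i, a)

/-- Apply `(H ⊗ I ⊗ ⋯ ⊗ I) P` a number of times. -/
noncomputable def iterateSteps (lit : ℕ → V) {m : ℕ} :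
    ℕ → ((Fin (m + 1) → F) → F → V) → Prog F V ((Fin (m + 1) → F) → F → V)
  | 0, D => .ret D
  | j + 1, D => (sparseStep lit (shuffle D)).bind (iterateSteps lit j)

/-- `B_z ⋆ S_w`, computed with the factorization `B_z = ((H ⊗ I ⊗ ⋯ ⊗ I) P) ^ m`. The entry at
`b` and `a` is the number of positions `x` with `a + ⟨b, x⟩ = w x`. -/
noncomputable def correlate (lit : ℕ → V) :
    (m : ℕ) → ((Fin m → F) → F) → Prog F V ((Fin m → F) → F → V)
  | 0, w => indicatorTable lit w
  | m + 1, w => (indicatorTable lit w).bind (iterateSteps lit (m + 1))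

end ReedMuller

/-! ## The improved Viterbi algorithm -/

section Improved

variable {F : Type u} [Field F] [Fintype F] [DecidableEq F] {V : Type} {k δ n : ℕ}

/-- The received symbol at the position of a column of the MacDonald matrix. -/
def symbolAt (col : Fin n ≃ MacDonaldColumn F k δ) (r : Fin n → F) (y : Fin (k + δ) → F) : F :=
  if h : IsNormalized k y then r (col.symm ⟨y, h⟩) else 0

/-- Distances between `r` and the codewords of the code generated by the first `h` rows of the
MacDonald matrix (for `h = k + δ` the MacDonald code, otherwise the code `𝒞'_h`). For every `i < k`
and every choice `z` of the last `k + δ - h` entries, the columns `(0, …, 0, 1, x, z)` with `i`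
leading zeros form, in the first `h` rows, a first order Reed–Muller code; the numbers of agreements
in these blocks are added up and subtracted from the length. -/
noncomputable def headDistances (lit : ℕ → V) (col : Fin n ≃ MacDonaldColumn F k δ)
    (r : Fin n → F) (h : ℕ) : Prog F V ((Fin (k + δ) → F) → V) :=
  (Prog.tabulate fun p : Fin k × (Fin (k + δ - h) → F) =>
      (correlate lit (h - 1 - p.1) fun x => symbolAt col r fun ρ : Fin (k + δ) =>
        if (ρ : ℕ) < p.1 then 0 else if (ρ : ℕ) = p.1 then 1
        else if (ρ : ℕ) < h then entry x (ρ - p.1 - 1) else entry p.2 (ρ - h)).bind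
      fun T => .ret fun y : Fin h → F => T (slice y (p.1 + 1) (h - 1 - p.1)) (entry y p.1)).bind
  fun T =>
    (Prog.tabulate fun y : Fin h → F =>
      (Prog.sum (lit 0) ((Finset.univ : Finset (Fin k × (Fin (k + δ - h) → F))).toList.map
          fun p => T p y)).bind
        fun a => .sub (lit n) a .ret).bind
    fun D => .ret fun y => D (slice y 0 h)

/-- Distances between `r` and the codewords of the code generated by the rows of the MacDonald
matrix from row `h` on, where `h` is a positive multiple of `k` (the code `ℛ*`). For every choice of
the first `h` entries, the columns form a generator matrix of a first order Reed–Muller code without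
its all-one row. -/
noncomputable def tailDistances (lit : ℕ → V) (col : Fin n ≃ MacDonaldColumn F k δ)
    (r : Fin n → F) (h : ℕ) : Prog F V ((Fin (k + δ) → F) → V) :=
  (Prog.tabulate fun p : {p : Fin h → F // IsNormalized k p} =>
      (correlate lit (k + δ - h) fun x => symbolAt col r fun ρ : Fin (k + δ) =>
        if (ρ : ℕ) < h then entry p.1 ρ else entry x (ρ - h)).bind
      fun T => .ret fun y : Fin (k + δ - h) → F => T y 0).bind
  fun T =>
    (Prog.tabulate fun y : Fin (k + δ - h) → F =>
      (Prog.sum (lit 0) ((Finset.univ : Finset {p : Fin h → F // IsNormalized k p}).toList.map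
          fun p => T p y)).bind
        fun a => .sub (lit n) a .ret).bind
    fun D => .ret fun y => D (slice y h (k + δ - h))

/-- The branch metrics of the improved Viterbi algorithm in its three phases `1 ≤ t ≤ μ`,
`μ + 1 ≤ t ≤ N - μ` and `N - μ + 1 ≤ t ≤ N`. -/
noncomputable def fastMetrics (lit : ℕ → V) (col : Fin n ≃ MacDonaldColumn F k δ) (N t : ℕ)
    (r : Fin n → F) : Prog F V ((Fin (k + δ) → F) → V) :=
  if t ≤ memory k δ then headDistances lit col r (t * k)
  else if t ≤ N - memory k δ then headDistances lit col r (k + δ)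
  else tailDistances lit col r ((t + memory k δ - N) * k)

/-- The improved Viterbi algorithm. -/
noncomputable def improvedViterbi (lit : ℕ → V) (col : Fin n ≃ MacDonaldColumn F k δ)
    (e : Fin (numLast k δ) ↪o Fin k) (N : ℕ) (coin : ℕ → (Fin (k + δ) → F) → Bool)
    (r : Fin n → F[X]) : Prog F V ((Fin k → F[X]) × V) :=
  trellisSearch lit e N coin fun t => fastMetrics lit col N t (coeffVec r (t - 1))

end Improved

end Viterbi

open Viterbi

namespace Viterbi

/-! ### Results and operation counts of the program combinators -/

namespace Prog

section

variable {F : Type u} [DecidableEq F] {α : Type v} {β : Type w} {ι : Type x}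

/-! Correctness is dynamic programming, and the complexity bounds come from counting branches and
columns.

A row of the stacked matrix is determined by its lag and its component. The path of a message
therefore has at each time a vector `branchOf`, which lists the input coefficients at the times "now
minus lag". The coefficient of the codeword at that time is this vector times the stacked matrix
(`coeffVec_vecMul_genMatrix`). Conversely, every branch of the terminated trellis lies on the path
of some admissible message (`exists_branchOf_eq`). Hence minimizing over incoming branches, by
induction on time, gives an optimal path into each reached state (`survivors_spec`). At time `N`
every admissible message is in the zero state, so the single remaining survivor is optimal. This
argument only needs correct branch metrics, and both algorithms use it.

For the improved metrics, the columns of the MacDonald matrix are split in two ways. In the first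
two phases the splitting is by the position of the leading one and the entries beyond the active
rows (`headColumn_bijective`). In the last phase it is by the entries in the inactive rows
(`tailColumn_bijective`). On each block the branch label is an affine, respectively linear, function
of the free entries. Agreements on a block are counted by a transform that treats one digit per step
(`transformStep_iterate`, `result_correlate`).

The same bijections show that the block lengths add up to `n`. A block of length `q ^ m` costs at
most `q ^ m * q * ((k + δ) * q)` operations, so all blocks together cost at most `(k + δ) * q ^ 2 *
n`. Adding up the blocks and the trellis step itself stay within a constant multiple of this.
Finally `k + δ` is at most `2 * log_q n`, because `q ^ (k + δ - 1) ≤ n`.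

The general algorithm spends between `n` and `4 * n` operations per branch. A full time step has `q
^ (k + δ)` branches, which is `q * n` up to a factor 2. The start and end phases are dominated by
geometric series and contribute only as much as four full steps (`sum_card_isBranch_le`). -/

@[simp]
theorem result_bind (p : Prog F ℤ α) (f : α → Prog F ℤ β) :
    (p.bind f).result = (f p.result).result := by
  induction p with
  | ret a => rfl
  | add _ _ _ ih => exact ih _
  | sub _ _ _ ih => exact ih _
  | le _ _ _ ih => exact ih _
  | eqSym _ _ _ ih => exact ih _

@[simp]
theorem ops_bind (p : Prog F ℤ α) (f : α → Prog F ℤ β) :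
    (p.bind f).ops = p.ops + (f p.result).ops := by
  induction p with
  | ret a => simp [bind, result, ops]
  | add _ _ _ ih => simp only [bind, result, ops, ih]; omega
  | sub _ _ _ ih => simp only [bind, result, ops, ih]; omega
  | le _ _ _ ih => simp only [bind, result, ops, ih]; omega
  | eqSym _ _ _ ih => simp only [bind, result, ops, ih]; omega

theorem result_tabulateFin (n : ℕ) (f : Fin n → Prog F ℤ β) :
    (tabulateFin n f).result = fun i => (f i).result := by
  induction n with
  | zero => funext i; exact i.elim0
  | succ n ih =>
    funext i
    simp only [tabulateFin, result_bind, ih, result]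
    refine Fin.cases ?_ (fun j => ?_) i <;> simp

theorem ops_tabulateFin (n : ℕ) (f : Fin n → Prog F ℤ β) :
    (tabulateFin n f).ops = ∑ i, (f i).ops := by
  induction n with
  | zero => simp [tabulateFin, ops]
  | succ n ih => simp [tabulateFin, ops, ih, Fin.sum_univ_succ]

@[simp]
theorem result_tabulate [Fintype ι] (f : ι → Prog F ℤ β) :
    (tabulate f).result = fun i => (f i).result := by
  funext i
  simp [tabulate, result_tabulateFin, result]

@[simp]
theorem ops_tabulate [Fintype ι] (f : ι → Prog F ℤ β) :
    (tabulate f).ops = ∑ i, (f i).ops := by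
  simp only [tabulate, ops_bind, ops_tabulateFin, ops, add_zero]
  exact Equiv.sum_comp (Fintype.equivFin ι).symm fun i => (f i).ops

theorem result_sumFrom (a : ℤ) (l : List ℤ) : (sumFrom (F := F) a l).result = a + l.sum := by
  induction l generalizing a with
  | nil => simp [sumFrom, result]
  | cons b l ih => simp [sumFrom, result, ih, add_assoc]

theorem ops_sumFrom (a : ℤ) (l : List ℤ) : (sumFrom (F := F) a l).ops = l.length := by
  induction l generalizing a with
  | nil => simp [sumFrom, ops]
  | cons b l ih => simp [sumFrom, ops, ih]

@[simp]
theorem result_sum (l : List ℤ) : (sum (F := F) (0 : ℤ) l).result = l.sum := by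
  cases l <;> simp [sum, result, result_sumFrom]

@[simp]
theorem ops_sum (z : ℤ) (l : List ℤ) : (sum (F := F) z l).ops = l.length - 1 := by
  cases l <;> simp [sum, ops, ops_sumFrom]

end

end Prog

/-! ## Indices of the stacked matrix -/

section Index

variable {k δ : ℕ}

theorem memory_mul_lt (hk : 1 ≤ k) : memory k δ * k < k + δ := by
  have h := Nat.div_mul_le_self (δ + k - 1) k
  rw [memory, Nat.ceilDiv_eq_add_pred_div]
  omega

theorem le_memory_mul (hk : 1 ≤ k) : δ ≤ memory k δ * k := by
  have h := Nat.lt_div_mul_add (a := δ + k - 1) (b := k) (by omega)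
  rw [memory, Nat.ceilDiv_eq_add_pred_div]
  omega

theorem lag_le_memory (ρ : Fin (k + δ)) : lag ρ ≤ memory k δ := by
  unfold lag
  split_ifs with h
  · exact (Nat.div_lt_of_lt_mul (by rwa [mul_comm] at h)).le
  · exact le_rfl

theorem lag_lt_iff (hk : 1 ≤ k) {ρ : Fin (k + δ)} {j : ℕ} (hj : j ≤ memory k δ) :
    lag ρ < j ↔ (ρ : ℕ) < j * k := by
  unfold lag
  split_ifs with h
  · exact Nat.div_lt_iff_lt_mul hk
  · have := Nat.mul_le_mul_right k hj
    omega

theorem lag_eq_zero_iff (hk : 1 ≤ k) {ρ : Fin (k + δ)} : lag ρ = 0 ↔ (ρ : ℕ) < k := by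
  rcases Nat.eq_zero_or_pos (memory k δ) with h0 | h0
  · have h1 := lag_le_memory ρ
    have h2 := le_memory_mul (δ := δ) hk
    have h3 := ρ.2
    simp only [h0, zero_mul] at h1 h2
    omega
  · have := lag_lt_iff hk (ρ := ρ) (j := 1) h0
    omega

/-- This is why the state at time `t` depends only on inputs strictly before `t`. -/
theorem lag_natAdd_pos (hk : 1 ≤ k) (j : Fin δ) : 0 < lag (Fin.natAdd k j) := by
  have := lag_eq_zero_iff hk (ρ := Fin.natAdd k j)
  simp only [Fin.val_natAdd] at this
  omega

variable (e : Fin (numLast k δ) ↪o Fin k)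

theorem component_of_lt_memory_mul {ρ : Fin (k + δ)} (h : (ρ : ℕ) < memory k δ * k) :
    (component e ρ : ℕ) = ρ % k := by
  simp [component, h]

/-- The row with a given lag below the memory and a given component. -/
theorem exists_row (hk : 1 ≤ k) {l : ℕ} (hl : l < memory k δ) (a : Fin k) :
    ∃ h : l * k + a < k + δ, lag (⟨l * k + a, h⟩ : Fin (k + δ)) = l ∧
      component e ⟨l * k + a, h⟩ = a := by
  have h1 : l * k + a < memory k δ * k := by
    have := Nat.mul_le_mul_right k (Nat.succ_le_of_lt hl)
    have := a.2
    rw [Nat.succ_mul] at *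
    omega
  have h2 := memory_mul_lt (δ := δ) hk
  refine ⟨by omega, ?_, ?_⟩
  · rw [lag, if_pos (by exact h1)]
    simp [Nat.add_comm (l * k), Nat.add_mul_div_right _ _ (show 0 < k by omega)]
  · ext
    rw [component_of_lt_memory_mul e h1]
    simp [Nat.add_comm (l * k), Nat.add_mul_mod_self_right, Nat.mod_eq_of_lt a.2]

theorem row_injective (hk : 1 ≤ k) {ρ σ : Fin (k + δ)} (hl : lag ρ = lag σ)
    (hc : component e ρ = component e σ) : ρ = σ := by
  have hρ := lag_lt_iff hk (ρ := ρ) (le_refl (memory k δ))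
  have hσ := lag_lt_iff hk (ρ := σ) (le_refl (memory k δ))
  ext
  by_cases h : (ρ : ℕ) < memory k δ * k
  · have h' : (σ : ℕ) < memory k δ * k := by rw [← hσ, ← hl, hρ]; exact h
    have h1 := component_of_lt_memory_mul e h
    have h2 := component_of_lt_memory_mul e h'
    rw [hc, h2] at h1
    rw [lag, lag, if_pos h, if_pos h'] at hl
    rw [← Nat.div_add_mod ρ k, ← Nat.div_add_mod σ k, hl, h1]
  · have h' : ¬ (σ : ℕ) < memory k δ * k := by rw [← hσ, ← hl, hρ]; exact h
    rw [component, component, dif_neg h, dif_neg h'] at hc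
    have := congrArg Fin.val (e.injective hc)
    simp only at this
    omega

theorem orderEmbedding_val_eq {a b : ℕ} (hab : a = b) (f : Fin a ↪o Fin b) (i : Fin a) :
    (f i : ℕ) = i := by
  subst hab
  have h1 : ∀ g : Fin a ≃o Fin a, g = OrderIso.refl _ := fun g => Subsingleton.elim _ _
  have hf : Function.Surjective f := Finite.surjective_of_injective f.injective
  have := h1 (RelIso.ofSurjective f hf)
  have := congrArg (fun g : Fin a ≃o Fin a => g i) this
  simp only [RelIso.ofSurjective_apply, OrderIso.refl_apply] at this
  rw [this]

/-- The delicate case is memory zero: the first `k` rows then form the last coefficient matrix, and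
`e` is an order embedding of `Fin k` into itself, hence the identity. This is the only place where
the monotonicity of `e` matters. -/
theorem component_castAdd (hk : 1 ≤ k) (a : Fin k) : component e (Fin.castAdd δ a) = a := by
  ext
  by_cases h : memory k δ = 0
  · have h2 := le_memory_mul (δ := δ) hk
    rw [component, dif_neg (by simp [h]), orderEmbedding_val_eq (by simp [numLast, h]; simpa [h] using h2)]
    simp [h]
  · have : k ≤ memory k δ * k := Nat.le_mul_of_pos_left k (by omega)
    have ha := a.2
    rw [component_of_lt_memory_mul e (by simp; omega)]
    simp [Nat.mod_eq_of_lt ha]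

end Index

/-! ## Messages as paths in the trellis -/

section Paths

variable {F : Type u} [Field F] {k δ n : ℕ}

/-- The branch into time `t + 1` of the path of a message. -/
noncomputable def branchOf (e : Fin (numLast k δ) ↪o Fin k) (t : ℕ) (p : Fin k → F[X]) :
    Fin (k + δ) → F :=
  fun ρ => if lag ρ ≤ t then (p (component e ρ)).coeff (t - lag ρ) else 0

/-- The state at time `t` of the path of a message. -/
noncomputable def stateOf (e : Fin (numLast k δ) ↪o Fin k) (t : ℕ) (p : Fin k → F[X]) :
    Fin δ → F :=
  startState (branchOf e t p)

theorem branchOf_congr (e : Fin (numLast k δ) ↪o Fin k) {t : ℕ} {p p' : Fin k → F[X]}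
    (h : ∀ a, ∀ i ≤ t, (p a).coeff i = (p' a).coeff i) : branchOf e t p = branchOf e t p' := by
  funext ρ
  unfold branchOf
  split_ifs
  · exact h _ _ (Nat.sub_le _ _)
  · rfl

theorem stateOf_congr (hk : 1 ≤ k) (e : Fin (numLast k δ) ↪o Fin k) {t : ℕ} {p p' : Fin k → F[X]}
    (h : ∀ a, ∀ i < t, (p a).coeff i = (p' a).coeff i) : stateOf e t p = stateOf e t p' := by
  funext j
  simp only [stateOf, startState, branchOf]
  split_ifs with hj
  · exact h _ _ (by have := lag_natAdd_pos hk j; omega)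
  · rfl

theorem endState_branchOf (hk : 1 ≤ k) (e : Fin (numLast k δ) ↪o Fin k) (t : ℕ)
    (p : Fin k → F[X]) : endState e (branchOf e t p) = stateOf e (t + 1) p := by
  funext j
  have h0 := lag_natAdd_pos hk j
  have h1 := lag_le_memory (Fin.natAdd k j)
  -- An entry of lag `l ≥ 1` in the new state was the entry of lag `l - 1` with the same component.
  -- Since `l - 1` is below the memory, that row exists for every component, including those missing
  -- from the last coefficient matrix.
  obtain ⟨h, hl, hc⟩ := exists_row e hk (l := lag (Fin.natAdd k j) - 1) (by omega)
    (component e (Fin.natAdd k j))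
  simp only [endState, entry, dif_pos h, branchOf, hl, hc, stateOf, startState]
  by_cases ht : lag (Fin.natAdd k j) ≤ t + 1
  · rw [if_pos ht, if_pos (by omega)]
    congr 1
    omega
  · rw [if_neg ht, if_neg (by omega)]

theorem isBranch_branchOf (hk : 1 ≤ k) (e : Fin (numLast k δ) ↪o Fin k) {N t : ℕ} (ht : t < N)
    {p : Fin k → F[X]} (hp : ∀ a, (p a).degree < ((N - memory k δ : ℕ) : WithBot ℕ)) :
    IsBranch N (t + 1) (branchOf e t p) := by
  intro ρ hρ
  unfold branchOf
  split_ifs with h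
  · rcases hρ with hρ | hρ
    · have h1 := memory_mul_lt (δ := δ) hk
      have h2 := le_memory_mul (δ := δ) hk
      have h3 := ρ.2
      -- Past the memory, `(t + 1) * k` is at least `k + δ`, so there is no row `ρ` left. Below it,
      -- a row from `(t + 1) * k` on has lag greater than `t`, against `h`.
      have h4 : t + 1 ≤ memory k δ := by
        by_contra! h4
        have := Nat.mul_le_mul_right k (Nat.succ_le_of_lt h4)
        rw [Nat.succ_mul] at this
        omega
      have := (lag_lt_iff hk (ρ := ρ) h4).1 (by omega)
      omega
    · have := (lag_lt_iff hk (ρ := ρ) (j := t + 1 + memory k δ - N) (by omega)).2 hρ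
      refine coeff_eq_zero_of_degree_lt ((hp _).trans_le ?_)
      exact_mod_cast (by omega : N - memory k δ ≤ t - lag ρ)
  · rfl

theorem exists_branchOf_eq (hk : 1 ≤ k) (e : Fin (numLast k δ) ↪o Fin k) {N t : ℕ} (ht : t < N)
    {y : Fin (k + δ) → F} (hy : IsBranch N (t + 1) y) :
    ∃ p : Fin k → F[X], (∀ a, (p a).degree < ((N - memory k δ : ℕ) : WithBot ℕ)) ∧
      branchOf e t p = y := by
  classical
  have hlarge : ∀ ρ : Fin (k + δ), ¬ lag ρ ≤ t → y ρ = 0 := fun ρ h => by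
    have h1 := lag_le_memory ρ
    have := (lag_lt_iff hk (ρ := ρ) (j := t + 1) (by omega))
    exact hy ρ (.inl (by omega))
  -- Each entry of `y` is written at the coefficient from which `branchOf` reads it. Distinct rows
  -- do not collide, by `row_injective`. Rows of lag greater than `t` would need negative times, and
  -- there `y` vanishes.
  refine ⟨fun a => ∑ ρ, if component e ρ = a ∧ lag ρ ≤ t then monomial (t - lag ρ) (y ρ) else 0,
    fun a => ?_, ?_⟩
  · rw [degree_lt_iff_coeff_zero]
    intro i hi
    rw [finsetSum_coeff]
    refine Finset.sum_eq_zero fun ρ _ => ?_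
    split_ifs with h
    · rw [coeff_monomial]
      split_ifs with h'
      · have h1 := lag_le_memory ρ
        have := (lag_lt_iff hk (ρ := ρ) (j := t + 1 + memory k δ - N) (by omega))
        exact hy ρ (.inr (this.1 (by omega)))
      · rfl
    · simp
  · funext ρ
    unfold branchOf
    split_ifs with h
    · rw [finsetSum_coeff, Finset.sum_eq_single ρ]
      · simp [h]
      · intro σ _ hσ
        split_ifs with h'
        · rw [coeff_monomial, if_neg]
          intro h''
          exact hσ (row_injective e hk (by omega) h'.1)
        · simp
      · simp
    · exact (hlarge ρ h).symm

theorem coeffVec_vecMul_genMatrix (M : Matrix (Fin (k + δ)) (Fin n) F)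
    (e : Fin (numLast k δ) ↪o Fin k) (p : Fin k → F[X]) (t : ℕ) :
    coeffVec (Matrix.vecMul p (genMatrix M e)) t = Matrix.vecMul (branchOf e t p) M := by
  funext c
  have h1 : ∀ a i, (p a * monomial i (coeffMatrix M e i a c)).coeff t =
      ∑ ρ, if lag ρ = i ∧ component e ρ = a then
        (if lag ρ ≤ t then (p (component e ρ)).coeff (t - lag ρ) else 0) * M ρ c else 0 := by
    intro a i
    rw [← C_mul_X_pow_eq_monomial, ← mul_assoc, coeff_mul_X_pow', coeff_mul_C, coeffMatrix,
      Matrix.of_apply, Finset.mul_sum]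
    split_ifs with h
    · refine Finset.sum_congr rfl fun ρ _ => ?_
      split_ifs with h1
      · rw [h1.1, h1.2]
      · omega
      · simp
    · refine (Finset.sum_eq_zero fun ρ _ => ?_).symm
      split_ifs with h1 h2
      · omega
      · simp
      · rfl
  simp only [coeffVec, Matrix.vecMul, dotProduct, genMatrix, Matrix.of_apply, Finset.mul_sum,
    finsetSum_coeff, h1, branchOf]
  rw [Finset.sum_congr rfl fun a _ => Finset.sum_comm, Finset.sum_comm]
  refine Finset.sum_congr rfl fun ρ _ => ?_
  -- Row `ρ` of the stacked matrix occurs in exactly one coefficient matrix and in exactly one row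
  -- of it.
  rw [Finset.sum_eq_single (component e ρ), Finset.sum_eq_single (lag ρ)]
  · simp
  · intro i _ hi
    rw [if_neg (by tauto)]
  · intro h
    exact absurd (Finset.mem_range.2 (Nat.lt_succ_of_le (lag_le_memory ρ))) h
  · intro a _ ha
    exact Finset.sum_eq_zero fun i _ => by rw [if_neg (by tauto)]
  · simp

end Paths

/-! ## One step in the trellis -/

section Lists

variable {F : Type u} [DecidableEq F] {k δ : ℕ}

theorem result_addMetrics (metric : (Fin δ → F) → ℤ) (d : (Fin (k + δ) → F) → ℤ)
    (l : List (Fin (k + δ) → F)) :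
    (addMetrics metric d l).result = l.map fun y => (metric (startState y) + d y, y) := by
  induction l with
  | nil => simp [addMetrics, Prog.result]
  | cons y l ih => simp [addMetrics, Prog.result, ih]

theorem ops_addMetrics (metric : (Fin δ → F) → ℤ) (d : (Fin (k + δ) → F) → ℤ)
    (l : List (Fin (k + δ) → F)) : (addMetrics metric d l).ops = l.length := by
  induction l with
  | nil => simp [addMetrics, Prog.ops]
  | cons y l ih => simp [addMetrics, Prog.ops, ih]

theorem result_select (coin : (Fin (k + δ) → F) → Bool) (c : ℤ × (Fin (k + δ) → F))
    (l : List (ℤ × (Fin (k + δ) → F))) :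
    (select coin c l).result ∈ c :: l ∧ ∀ c' ∈ c :: l, (select coin c l).result.1 ≤ c'.1 := by
  induction l generalizing c with
  | nil => simp [select, Prog.result]
  | cons b l ih =>
    -- Whatever `coin` says, the winner of one comparison is below both candidates; `coin` only
    -- matters when they are equal.
    obtain ⟨x, hx, hxb, hxc, hsel⟩ : ∃ x, (x = c ∨ x = b) ∧ x.1 ≤ b.1 ∧ x.1 ≤ c.1 ∧
        (select coin c (b :: l)).result = (select coin x l).result := by
      rw [select]
      split
      · by_cases h : b.1 ≤ c.1
        · exact ⟨b, .inr rfl, le_rfl, h, by simp [Prog.result, h]⟩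
        · exact ⟨c, .inl rfl, by omega, le_rfl, by simp [Prog.result, h]⟩
      · by_cases h : c.1 ≤ b.1
        · exact ⟨c, .inl rfl, h, le_rfl, by simp [Prog.result, h]⟩
        · exact ⟨b, .inr rfl, le_rfl, by omega, by simp [Prog.result, h]⟩
    obtain ⟨h1, h2⟩ := ih x
    rw [hsel]
    have h3 := h2 x (by simp)
    refine ⟨?_, ?_⟩
    · rcases List.mem_cons.1 h1 with h | h
      · rw [h]; rcases hx with rfl | rfl <;> simp
      · simp [h]
    · intro c' hc'
      rcases List.mem_cons.1 hc' with rfl | hc'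
      · exact h3.trans hxc
      · rcases List.mem_cons.1 hc' with rfl | hc'
        · exact h3.trans hxb
        · exact h2 c' (by simp [hc'])

theorem ops_select (coin : (Fin (k + δ) → F) → Bool) (c : ℤ × (Fin (k + δ) → F))
    (l : List (ℤ × (Fin (k + δ) → F))) : (select coin c l).ops = l.length := by
  induction l generalizing c with
  | nil => simp [select, Prog.ops]
  | cons b l ih => rw [select]; split <;> simp [Prog.ops, ih]

end Lists

section Distances

variable {F : Type u} [Field F] [DecidableEq F] {k δ : ℕ}

theorem seqDist_succ {n : ℕ} (t : ℕ) (p r : Fin n → F[X]) :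
    seqDist (t + 1) p r = seqDist t p r + hammingDist (coeffVec p t) (coeffVec r t) :=
  Finset.sum_range_succ _ _

theorem seqDist_genMatrix_congr {n : ℕ} (M : Matrix (Fin (k + δ)) (Fin n) F)
    (e : Fin (numLast k δ) ↪o Fin k) {t : ℕ} {p p' : Fin k → F[X]}
    (h : ∀ a, ∀ i < t, (p a).coeff i = (p' a).coeff i) (r : Fin n → F[X]) :
    seqDist t (Matrix.vecMul p (genMatrix M e)) r =
      seqDist t (Matrix.vecMul p' (genMatrix M e)) r := by
  refine Finset.sum_congr rfl fun i hi => ?_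
  rw [coeffVec_vecMul_genMatrix, coeffVec_vecMul_genMatrix,
    branchOf_congr e fun a j hj => h a j (by have := Finset.mem_range.1 hi; omega)]

end Distances

/-! ### A single step, the survivors, and the complete search -/

section Step

variable {F : Type u} [Field F] [Fintype F] [DecidableEq F] {k δ : ℕ}

/-- The branch `y₀` guarantees that the list of branches into its end state is nonempty, so the
default survivor is never returned for this state. -/
theorem exists_result_trellisStep (lit : ℕ → ℤ) (e : Fin (numLast k δ) ↪o Fin k) (N : ℕ)
    (coin : ℕ → (Fin (k + δ) → F) → Bool) (t : ℕ)
    (surv : (Fin δ → F) → ℤ × (Fin k → F[X])) (d : (Fin (k + δ) → F) → ℤ)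
    {y₀ : Fin (k + δ) → F} (h₀ : IsBranch N t y₀) :
    ∃ y, IsBranch N t y ∧ endState e y = endState e y₀ ∧
      (∀ y', IsBranch N t y' → endState e y' = endState e y₀ →
        (surv (startState y)).1 + d y ≤ (surv (startState y')).1 + d y') ∧
      (trellisStep lit e N coin t surv d).result (endState e y₀) =
        ((surv (startState y)).1 + d y, fun a =>
          (surv (startState y)).2 a + monomial (t - 1) (y (Fin.castAdd δ a))) := by
  set l := ({y | IsBranch N t y ∧ endState e y = endState e y₀} :
    Finset (Fin (k + δ) → F)).toList with hl
  have hmem : ∀ y, y ∈ l ↔ IsBranch N t y ∧ endState e y = endState e y₀ := by simp [hl]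
  set g : (Fin (k + δ) → F) → ℤ × (Fin (k + δ) → F) :=
    fun y => ((surv (startState y)).1 + d y, y) with hg
  simp only [trellisStep, Prog.result_tabulate, Prog.result_bind, result_addMetrics, ← hl, ← hg]
  have hy₀ : y₀ ∈ l := (hmem _).2 ⟨h₀, rfl⟩
  cases hlg : l.map g with
  | nil => simp [List.map_eq_nil_iff.1 hlg] at hy₀
  | cons c cs =>
    obtain ⟨h1, h2⟩ := result_select (coin t) c cs
    rw [← hlg] at h1 h2
    obtain ⟨y, hy, hyc⟩ := List.mem_map.1 h1
    refine ⟨y, ((hmem y).1 hy).1, ((hmem y).1 hy).2, fun y' h3 h4 => ?_, ?_⟩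
    · have := h2 (g y') (List.mem_map_of_mem ((hmem y').2 ⟨h3, h4⟩))
      rw [← hyc] at this
      exact this
    · simp only [Prog.result_bind, ← hyc]
      rfl

/-- The branches are partitioned by their end states. Each one costs one addition and, except for
one in each nonempty class, one comparison. -/
theorem ops_trellisStep_le (lit : ℕ → ℤ) (e : Fin (numLast k δ) ↪o Fin k) (N : ℕ)
    (coin : ℕ → (Fin (k + δ) → F) → Bool) (t : ℕ)
    (surv : (Fin δ → F) → ℤ × (Fin k → F[X])) (d : (Fin (k + δ) → F) → ℤ) :
    (trellisStep lit e N coin t surv d).ops ≤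
      2 * Fintype.card {y : Fin (k + δ) → F // IsBranch N t y} := by
  have hcard : Fintype.card {y : Fin (k + δ) → F // IsBranch N t y} =
      ∑ s : Fin δ → F, ({y | IsBranch N t y ∧ endState e y = s} :
        Finset (Fin (k + δ) → F)).card := by
    rw [Fintype.card_subtype,
      Finset.card_eq_sum_card_fiberwise (f := endState e) (t := Finset.univ) (by simp)]
    simp [Finset.filter_filter]
  rw [trellisStep, Prog.ops_tabulate, hcard, Finset.mul_sum]
  refine Finset.sum_le_sum fun s _ => ?_
  rw [Prog.ops_bind, ops_addMetrics, result_addMetrics, ← Finset.length_toList]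
  set l := ({y | IsBranch N t y ∧ endState e y = s} : Finset (Fin (k + δ) → F)).toList
  cases l with
  | nil => simp [Prog.ops]
  | cons c cs => simp [Prog.ops, ops_select]; omega

/-- `d` contains the distances of `r` to the labels of all branches into time `t`. -/
def IsBranchMetric {n : ℕ} (M : Matrix (Fin (k + δ)) (Fin n) F) (N t : ℕ) (r : Fin n → F)
    (d : (Fin (k + δ) → F) → ℤ) : Prop :=
  ∀ y, IsBranch N t y → d y = hammingDist (Matrix.vecMul y M) r

/-- The survivor in each state that is reached is a shortest path into this state. -/
theorem survivors_spec (hk : 1 ≤ k) {n : ℕ} (M : Matrix (Fin (k + δ)) (Fin n) F)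
    (e : Fin (numLast k δ) ↪o Fin k) {N : ℕ} (coin : ℕ → (Fin (k + δ) → F) → Bool)
    (r : Fin n → F[X]) (metrics : ℕ → Prog F ℤ ((Fin (k + δ) → F) → ℤ)) (lit : ℕ → ℤ)
    (hlit : lit 0 = 0)
    (hmetrics : ∀ t < N, IsBranchMetric M N (t + 1) (coeffVec r t) (metrics (t + 1)).result)
    {t : ℕ} (ht : t ≤ N) {m : Fin k → F[X]}
    (hm : ∀ a, (m a).degree < ((N - memory k δ : ℕ) : WithBot ℕ)) :
    ∃ p, (survivors lit e N coin metrics t).result (stateOf e t m) =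
        (((seqDist t (Matrix.vecMul p (genMatrix M e)) r : ℕ) : ℤ), p) ∧
      (∀ a, (p a).degree < ((N - memory k δ : ℕ) : WithBot ℕ)) ∧
      (∀ a, (p a).degree < (t : WithBot ℕ)) ∧
      stateOf e t p = stateOf e t m ∧
      seqDist t (Matrix.vecMul p (genMatrix M e)) r ≤
        seqDist t (Matrix.vecMul m (genMatrix M e)) r := by
  -- The message `m` only names a reached state and competes with the survivor. It must vary, since
  -- the selected branch may leave the path of `m`. The bound of the degree by `t` ensures that the
  -- next monomial sets a coefficient that was zero.
  induction t generalizing m with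
  | zero =>
    refine ⟨0, ?_, ?_, ?_, stateOf_congr hk e (by simp), ?_⟩
    · simp [survivors, Prog.result, hlit, seqDist]
    · simp
    · simp
    · simp [seqDist]
  | succ t ih =>
    set d := (metrics (t + 1)).result with hd
    set surv := (survivors lit e N coin metrics t).result with hsurv
    have hres : (survivors lit e N coin metrics (t + 1)).result =
        (trellisStep lit e N coin (t + 1) surv d).result := by
      simp [survivors, hsurv, hd]
    obtain ⟨y, hy, hye, hmin, heq⟩ := exists_result_trellisStep lit e N coin (t + 1) surv d
      (isBranch_branchOf hk e (t := t) (by omega) hm)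
    rw [endState_branchOf hk] at hye hmin heq
    rw [hres, heq]
    -- The induction hypothesis is used twice: for a message `x` through the selected branch, to
    -- identify the survivor that gets extended, and for `m`, to bound the competing path.
    obtain ⟨x, hx, hxy⟩ := exists_branchOf_eq hk e (t := t) (by omega) hy
    obtain ⟨p, hp, hpN, hpt, hps, -⟩ := ih (by omega) hx
    obtain ⟨m', hm', -, -, -, hle⟩ := ih (by omega) hm
    have hstart : startState y = stateOf e t x := by rw [← hxy]; rfl
    rw [hstart, hp]
    set p' : Fin k → F[X] := fun a => p a + monomial (t + 1 - 1) (y (Fin.castAdd δ a)) with hp'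
    have hcoeff : ∀ a, ∀ i < t, (p' a).coeff i = (p a).coeff i := fun a i hi => by
      simp [hp', coeff_monomial, hi.ne']
    have hcoeff_t : ∀ a, (p' a).coeff t = y (Fin.castAdd δ a) := fun a => by
      simp [hp', coeff_eq_zero_of_degree_lt (hpt a)]
    have hbranch : branchOf e t p' = y := by
      funext ρ
      refine Fin.addCases (fun a => ?_) (fun j => ?_) ρ
      · have h0 : lag (Fin.castAdd δ a) = 0 := (lag_eq_zero_iff hk).2 (by simp)
        simp only [branchOf, h0, Nat.zero_le, if_true, component_castAdd e hk, Nat.sub_zero]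
        exact hcoeff_t a
      · have h1 := congrFun (stateOf_congr hk e hcoeff) j
        have h2 := congrFun (hps.trans hstart.symm) j
        exact h1.trans h2
    have hdist : seqDist (t + 1) (Matrix.vecMul p' (genMatrix M e)) r =
        seqDist t (Matrix.vecMul p (genMatrix M e)) r +
          hammingDist (Matrix.vecMul y M) (coeffVec r t) := by
      rw [seqDist_succ, seqDist_genMatrix_congr M e hcoeff, coeffVec_vecMul_genMatrix, hbranch]
    refine ⟨p', ?_, fun a => ?_, fun a => ?_, ?_, ?_⟩
    · rw [hdist, hd, hmetrics t (by omega) y hy]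
      simp
    · by_cases htN : t < N - memory k δ
      · refine (degree_add_le _ _).trans_lt (max_lt (hpN a) ?_)
        exact (degree_monomial_le _ _).trans_lt (by exact_mod_cast htN)
      -- In the final `μ` steps the input part of a branch is zero, so the extension does not raise
      -- the degree.
      · have : y (Fin.castAdd δ a) = 0 := by
          have h0 : lag (Fin.castAdd δ a) = 0 := (lag_eq_zero_iff hk).2 (by simp)
          rw [← hxy]
          simp only [branchOf, h0, Nat.zero_le, if_true, Nat.sub_zero]
          refine coeff_eq_zero_of_degree_lt ((hx _).trans_le ?_)
          exact_mod_cast (by omega : N - memory k δ ≤ t)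
        simpa [hp', this] using hpN a
    · refine (degree_add_le _ _).trans_lt (max_lt ((hpt a).trans ?_) ?_)
      · exact_mod_cast Nat.lt_succ_self t
      · exact (degree_monomial_le _ _).trans_lt (by exact_mod_cast Nat.lt_succ_self t)
    · rw [← endState_branchOf hk, hbranch, hye]
    · have h1 := hmin (branchOf e t m) (isBranch_branchOf hk e (by omega) hm)
        (endState_branchOf hk e t m)
      rw [hd, hmetrics t (by omega) y hy,
        hmetrics t (by omega) _ (isBranch_branchOf hk e (by omega) hm), hstart, hp] at h1
      rw [show startState (branchOf e t m) = stateOf e t m from rfl, hm'] at h1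
      rw [hdist, seqDist_succ, coeffVec_vecMul_genMatrix]
      simp only at h1
      omega

theorem isNearestMessage_trellisSearch (hk : 1 ≤ k) {n : ℕ}
    (M : Matrix (Fin (k + δ)) (Fin n) F) (e : Fin (numLast k δ) ↪o Fin k) {N : ℕ}
    (hN : memory k δ ≤ N) (coin : ℕ → (Fin (k + δ) → F) → Bool)
    (r : Fin n → F[X]) (metrics : ℕ → Prog F ℤ ((Fin (k + δ) → F) → ℤ)) (lit : ℕ → ℤ)
    (hlit : lit 0 = 0)
    (hmetrics : ∀ t < N, IsBranchMetric M N (t + 1) (coeffVec r t) (metrics (t + 1)).result) :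
    IsNearestMessage M e N r (trellisSearch lit e N coin metrics).result := by
  -- The state at time `N` reads only coefficients at `N - μ` and later, which vanish for admissible
  -- messages. Hence all of them compete for the same survivor.
  have hstate : ∀ m : Fin k → F[X],
      (∀ a, (m a).degree < ((N - memory k δ : ℕ) : WithBot ℕ)) → stateOf e N m = 0 := by
    intro m hm
    funext j
    have := lag_le_memory (Fin.natAdd k j)
    simp only [stateOf, startState, branchOf, Pi.zero_apply, ite_eq_right_iff]
    refine fun _ => coeff_eq_zero_of_degree_lt ((hm _).trans_le ?_)
    exact_mod_cast (by omega : N - memory k δ ≤ N - lag (Fin.natAdd k j))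
  have key := fun m hm => survivors_spec hk M e coin r metrics lit hlit hmetrics le_rfl (m := m) hm
  obtain ⟨p, hp, hpN, -, -, -⟩ := key 0 (by simp)
  rw [hstate 0 (by simp)] at hp
  have hres : (trellisSearch lit e N coin metrics).result =
      (p, ((seqDist N (Matrix.vecMul p (genMatrix M e)) r : ℕ) : ℤ)) := by
    simp [trellisSearch, Prog.result, hp]
  rw [hres]
  refine ⟨hpN, rfl, fun m hm => ?_⟩
  obtain ⟨p', hp', -, -, -, hle⟩ := key m hm
  rw [hstate m hm, hp] at hp'
  have : p = p' := (Prod.ext_iff.1 hp').2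
  rwa [← this] at hle

/-- The operations of the trellis search are those of the branch metrics and those of the steps. -/
theorem ops_trellisSearch (e : Fin (numLast k δ) ↪o Fin k) (N : ℕ)
    (coin : ℕ → (Fin (k + δ) → F) → Bool) (metrics : ℕ → Prog F ℤ ((Fin (k + δ) → F) → ℤ))
    (lit : ℕ → ℤ) :
    ∑ t ∈ Finset.range N, (metrics (t + 1)).ops ≤ (trellisSearch lit e N coin metrics).ops ∧
    (trellisSearch lit e N coin metrics).ops ≤ ∑ t ∈ Finset.range N, ((metrics (t + 1)).ops +
      2 * Fintype.card {y : Fin (k + δ) → F // IsBranch N (t + 1) y}) := by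
  have key : ∀ t, ∑ i ∈ Finset.range t, (metrics (i + 1)).ops ≤
      (survivors lit e N coin metrics t).ops ∧
      (survivors lit e N coin metrics t).ops ≤ ∑ i ∈ Finset.range t, ((metrics (i + 1)).ops +
        2 * Fintype.card {y : Fin (k + δ) → F // IsBranch N (i + 1) y}) := by
    intro t
    induction t with
    | zero => simp [survivors, Prog.ops]
    | succ t ih =>
      have h := ops_trellisStep_le lit e N coin (t + 1)
        (survivors lit e N coin metrics t).result (metrics (t + 1)).result
      rw [Finset.sum_range_succ, Finset.sum_range_succ]
      simp only [survivors, Prog.ops_bind]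
      omega
  simpa [trellisSearch, Prog.ops] using key N

end Step

/-! ## The correlation transform -/

section Indicator

variable {F : Type u} [Fintype F] [DecidableEq F]

theorem result_indicatorTable {m : ℕ} (w : (Fin m → F) → F) :
    (indicatorTable (Nat.cast : ℕ → ℤ) w).result = fun i a => if w i = a then 1 else 0 := by
  funext i a
  by_cases h : w i = a <;> simp [indicatorTable, Prog.result, h]

theorem ops_indicatorTable {m : ℕ} (w : (Fin m → F) → F) :
    (indicatorTable (Nat.cast : ℕ → ℤ) w).ops = Fintype.card F ^ (m + 1) := by
  simp [indicatorTable, Prog.ops, pow_succ]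

end Indicator

section Correlation

variable {F : Type u} [Field F] [Fintype F] [DecidableEq F]

/-- One step `(H ⊗ I ⊗ ⋯ ⊗ I) P` of the transform. -/
def transformStep {m : ℕ} (D : (Fin (m + 1) → F) → F → ℤ) : (Fin (m + 1) → F) → F → ℤ :=
  fun i a => ∑ x, D (Function.update i (Fin.last m) x ∘ (finRotate (m + 1)).symm)
    (a + i (Fin.last m) * x)

theorem result_sparseStep_shuffle {m : ℕ} (D : (Fin (m + 1) → F) → F → ℤ) :
    (sparseStep Nat.cast (shuffle D)).result = transformStep D := by
  funext i a
  simp [sparseStep, Prog.result, shuffle, transformStep]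

theorem ops_sparseStep {m : ℕ} (D : (Fin (m + 1) → F) → F → ℤ) :
    (sparseStep Nat.cast D).ops = Fintype.card F ^ (m + 2) * (Fintype.card F - 1) := by
  simp [sparseStep, Prog.ops, pow_succ]

theorem result_iterateSteps {m : ℕ} (j : ℕ) (D : (Fin (m + 1) → F) → F → ℤ) :
    (iterateSteps Nat.cast j D).result = transformStep^[j] D := by
  induction j generalizing D with
  | zero => rfl
  | succ j ih => simp [iterateSteps, ih, result_sparseStep_shuffle]

theorem ops_iterateSteps {m : ℕ} (j : ℕ) (D : (Fin (m + 1) → F) → F → ℤ) :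
    (iterateSteps Nat.cast j D).ops =
      j * (Fintype.card F ^ (m + 2) * (Fintype.card F - 1)) := by
  induction j generalizing D with
  | zero => simp [iterateSteps, Prog.ops]
  | succ j ih => simp only [iterateSteps, Prog.ops_bind, ih, ops_sparseStep]; ring

/-- Positions are added cyclically. The last position is `-1`, which rotation by `J + 1` sends to
`J`; undoing one place of the rotation leaves rotation by `J`. Thus a step of the transform acts on
digit `J` while the shuffle moves on to the next digit. -/
theorem update_comp_finRotate_symm {A : Type v} {m : ℕ} (i : Fin (m + 1) → A)
    (J : Fin (m + 1)) (c : A) :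
    Function.update (fun p => i (p + (J + 1))) (Fin.last m) c ∘ (finRotate (m + 1)).symm =
      fun p => Function.update i J c (p + J) := by
  funext p
  have hp : (finRotate (m + 1)).symm p = p - 1 := by
    rw [Equiv.symm_apply_eq, finRotate_apply, sub_add_cancel]
  rw [Function.comp_apply, hp]
  by_cases h : p = 0
  · have : (0 : Fin (m + 1)) - 1 = Fin.last m := by
      rw [sub_eq_iff_eq_add, Fin.last_add_one]
    simp [h, this]
  · have h1 : p - 1 ≠ Fin.last m := fun h' => h (by
      rw [sub_eq_iff_eq_add, Fin.last_add_one] at h'; exact h')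
    have h2 : p + J ≠ J := fun h' => h (by simpa using h')
    rw [Function.update_of_ne h1, Function.update_of_ne h2]
    congr 1
    abel

/-- After `j` steps the first `j` digits have been transformed, up to a rotation of the digits. -/
theorem transformStep_iterate {m : ℕ} (D : (Fin (m + 1) → F) → F → ℤ) {j : ℕ} (hj : j ≤ m + 1)
    (i : Fin (m + 1) → F) (a : F) :
    transformStep^[j] D (fun p => i (p + Fin.ofNat (m + 1) j)) a =
      ∑ x : Fin (m + 1) → F, if ∀ l : Fin (m + 1), j ≤ l → x l = i l then
        D x (a + ∑ l : Fin (m + 1), if (l : ℕ) < j then i l * x l else 0) else 0 := by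
  induction j generalizing i a with
  | zero =>
    rw [Finset.sum_eq_single i]
    · simp
    · intro x _ hx
      rw [if_neg]
      exact fun h => hx (funext fun l => h l (Nat.zero_le _))
    · simp
  | succ j ih =>
    set J : Fin (m + 1) := Fin.ofNat (m + 1) j with hJ
    have hJv : (J : ℕ) = j := Nat.mod_eq_of_lt (by omega)
    have hJs : Fin.ofNat (m + 1) (j + 1) = J + 1 := by
      ext; simp [hJ, Fin.val_add]
    have hlast : Fin.last m + (J + 1) = J := by
      rw [add_comm J, ← add_assoc, Fin.last_add_one, zero_add]
    rw [Function.iterate_succ_apply', transformStep]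
    simp only [hJs, update_comp_finRotate_symm, hlast]
    rw [Finset.sum_congr rfl fun c _ => ih (by omega) (Function.update i J c) (a + i J * c),
      Finset.sum_comm]
    refine Finset.sum_congr rfl fun x _ => ?_
    -- The induction hypothesis still requires `x` to agree with the updated index at `J`, which
    -- forces the new summation variable to be `x J`. The shift `i J * x J` then joins the partial
    -- inner product.
    rw [Finset.sum_eq_single (x J)]
    · have hcond : (∀ l : Fin (m + 1), j ≤ l → x l = Function.update i J (x J) l) ↔
          ∀ l : Fin (m + 1), j + 1 ≤ l → x l = i l := by
        constructor
        · intro h l hl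
          have hne : l ≠ J := fun h' => by rw [h'] at hl; omega
          have := h l (by omega)
          rwa [Function.update_of_ne hne] at this
        · intro h l hl
          by_cases hne : l = J
          · rw [hne, Function.update_self]
          · rw [Function.update_of_ne hne]
            have : (l : ℕ) ≠ J := fun h' => hne (Fin.ext h')
            exact h l (by omega)
      have hsum : a + i J * x J +
            (∑ l : Fin (m + 1), if (l : ℕ) < j then Function.update i J (x J) l * x l else 0) =
          a + ∑ l : Fin (m + 1), if (l : ℕ) < j + 1 then i l * x l else 0 := by
        rw [add_assoc, ← Finset.add_sum_erase _ _ (Finset.mem_univ J),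
          ← Finset.add_sum_erase (a := J) _ (fun l : Fin (m + 1) => if (l : ℕ) < j + 1 then i l * x l else 0)
            (Finset.mem_univ J),
          if_neg (by omega), if_pos (by omega), zero_add]
        congr 2
        refine Finset.sum_congr rfl fun l hl => ?_
        have hne := (Finset.mem_erase.1 hl).1
        have : (l : ℕ) ≠ J := fun h' => hne (Fin.ext h')
        rw [Function.update_of_ne hne]
        exact if_congr (by omega) rfl rfl
      simp only [hcond, hsum]
    · intro c _ hc
      rw [if_neg]
      intro h
      have := h J hJv.ge
      rw [Function.update_self] at this
      exact hc this.symm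
    · simp

/-- The transform counts agreements with the codewords of a first order Reed–Muller code. -/
theorem result_correlate (m : ℕ) (w : (Fin m → F) → F) (b : Fin m → F) (a : F) :
    (correlate (Nat.cast : ℕ → ℤ) m w).result b a =
      ∑ x : Fin m → F, if a + b ⬝ᵥ x = w x then 1 else 0 := by
  cases m with
  | zero =>
    obtain rfl : b = default := Subsingleton.elim _ _
    rw [Fintype.sum_unique]
    simp [correlate, result_indicatorTable, eq_comm]
  | succ m =>
    rw [correlate, Prog.result_bind, result_iterateSteps]
    have h := transformStep_iterate (indicatorTable (Nat.cast : ℕ → ℤ) w).result le_rfl b a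
    -- After `m + 1` steps the rotation has made a full turn.
    have h1 : (fun p => b (p + Fin.ofNat (m + 1) (m + 1))) = b := by
      funext p
      rw [Fin.ofNat_self, add_zero]
    rw [h1] at h
    rw [h]
    refine Finset.sum_congr rfl fun x _ => ?_
    rw [if_pos fun l hl => absurd l.2 (by omega), result_indicatorTable]
    simp [dotProduct, eq_comm, Fin.is_le]

theorem ops_correlate (m : ℕ) (w : (Fin m → F) → F) :
    (correlate (Nat.cast : ℕ → ℤ) m w).ops =
      Fintype.card F ^ (m + 1) * (1 + m * (Fintype.card F - 1)) := by
  cases m with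
  | zero => simp [correlate, ops_indicatorTable]
  | succ m =>
    rw [correlate, Prog.ops_bind, ops_iterateSteps, ops_indicatorTable]
    ring

end Correlation

/-! ## Columns of the MacDonald matrix -/

section Columns

variable {F : Type u} [Field F]

theorem entry_val {l : ℕ} (y : Fin l → F) (i : Fin l) : entry y i = y i := by
  simp [entry]

theorem entry_slice {l : ℕ} (y : Fin l → F) (s : ℕ) {len i : ℕ} (h : i < len) :
    entry (slice y s len) i = entry y (s + i) := by
  simp [entry, slice, h]

theorem slice_slice {l : ℕ} (y : Fin l → F) {len s len' : ℕ} (h : s + len' ≤ len) :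
    slice (slice y 0 len) s len' = slice y s len' := by
  funext j
  have := j.2
  rw [slice, entry_slice _ _ (by omega), zero_add, slice]

theorem dotProduct_eq_sum_range {l : ℕ} (y : Fin l → F) (g : ℕ → F) :
    (y ⬝ᵥ fun ρ : Fin l => g ρ) = ∑ ρ ∈ Finset.range l, entry y ρ * g ρ := by
  rw [← Fin.sum_univ_eq_sum_range (fun ρ => entry y ρ * g ρ)]
  simp [dotProduct, entry_val]

theorem slice_dotProduct {l : ℕ} (y : Fin l → F) (s len : ℕ) (x : Fin len → F) :
    slice y s len ⬝ᵥ x = ∑ j ∈ Finset.range len, entry y (s + j) * entry x j := by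
  rw [← Fin.sum_univ_eq_sum_range (fun j => entry y (s + j) * entry x j)]
  simp [dotProduct, entry_val, slice]

/-- The vector `(0, …, 0, 1, x, z)` with `i` leading zeros, where `z` starts at position `h`. -/
def headColumn (l h i : ℕ) (z : Fin (l - h) → F) (x : Fin (h - 1 - i) → F) : Fin l → F :=
  fun ρ => if (ρ : ℕ) < i then 0 else if (ρ : ℕ) = i then 1
    else if (ρ : ℕ) < h then entry x (ρ - i - 1) else entry z (ρ - h)

/-- The vector `(p, x)`, where `x` starts at position `h`. -/
def tailColumn (l h : ℕ) (p : Fin h → F) (x : Fin (l - h) → F) : Fin l → F :=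
  fun ρ => if (ρ : ℕ) < h then entry p ρ else entry x (ρ - h)

variable {k l h : ℕ}

theorem isNormalized_headColumn (hkh : k ≤ h) (hhl : h ≤ l) (i : Fin k) (z : Fin (l - h) → F)
    (x : Fin (h - 1 - i) → F) : IsNormalized k (headColumn l h i z x) := by
  have hi := i.2
  refine ⟨⟨i, by omega⟩, hi, ?_, fun j hj => ?_⟩
  · simp [headColumn]
  · have : (j : ℕ) < i := hj
    simp [headColumn, this]

theorem isNormalized_tailColumn (hhl : h ≤ l) {p : Fin h → F}
    (hp : IsNormalized k p) (x : Fin (l - h) → F) : IsNormalized k (tailColumn l h p x) := by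
  obtain ⟨i, hi, h1, h0⟩ := hp
  have hi' := i.2
  refine ⟨⟨i, by omega⟩, hi, ?_, fun j hj => ?_⟩
  · simp [tailColumn, entry_val, h1]
  · have hj' : (j : ℕ) < i := hj
    have := h0 ⟨j, by omega⟩ hj'
    simp only [tailColumn, if_pos (show (j : ℕ) < h by omega)]
    rw [← this, entry, dif_pos]

/-- The entries before the leading one meet zeros of the column, and those from `h` on vanish in
`y`. The leading one supplies the constant term, i.e. the all-one row of the Reed–Muller code. -/
theorem dotProduct_headColumn (_ : k ≤ h) (hhl : h ≤ l) (i : Fin k) (z : Fin (l - h) → F)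
    (x : Fin (h - 1 - i) → F) {y : Fin l → F} (hy : ∀ ρ : Fin l, h ≤ ρ → y ρ = 0) :
    y ⬝ᵥ headColumn l h i z x = entry y i + slice y (i + 1) (h - 1 - i) ⬝ᵥ x := by
  have hi := i.2
  unfold headColumn
  rw [dotProduct_eq_sum_range y fun ρ => if ρ < i then 0 else if ρ = i then 1
    else if ρ < h then entry x (ρ - i - 1) else entry z (ρ - h), slice_dotProduct]
  obtain ⟨c, hc⟩ : ∃ c, l = (i + 1 + (h - 1 - i)) + c := ⟨l - h, by omega⟩
  rw [show Finset.range l = Finset.range ((i + 1 + (h - 1 - i)) + c) by rw [← hc],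
    Finset.sum_range_add, Finset.sum_range_add, Finset.sum_range_succ,
    Finset.sum_eq_zero (s := Finset.range i), Finset.sum_eq_zero (s := Finset.range c)]
  · simp only [lt_irrefl, if_false, if_true, mul_one, zero_add, add_zero]
    congr 1
    refine Finset.sum_congr rfl fun j hj => ?_
    have := Finset.mem_range.1 hj
    rw [if_neg (by omega), if_neg (by omega), if_pos (by omega)]
    congr 2
    omega
  · intro j hj
    have hj := Finset.mem_range.1 hj
    rw [entry, dif_pos (by omega), hy _ (by simp only; omega), zero_mul]
  · intro j hj
    rw [if_pos (Finset.mem_range.1 hj), mul_zero]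

/-- Here the fixed part `p` of the column only meets zeros of `y`. No constant term remains, which
is why only the entry at `0` of the correlation table is needed. -/
theorem dotProduct_tailColumn (hhl : h ≤ l) (p : Fin h → F) (x : Fin (l - h) → F)
    {y : Fin l → F} (hy : ∀ ρ : Fin l, (ρ : ℕ) < h → y ρ = 0) :
    y ⬝ᵥ tailColumn l h p x = slice y h (l - h) ⬝ᵥ x := by
  unfold tailColumn
  rw [dotProduct_eq_sum_range y fun ρ => if ρ < h then entry p ρ else entry x (ρ - h),
    slice_dotProduct]
  rw [show Finset.range l = Finset.range (h + (l - h)) by congr 1; omega,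
    Finset.sum_range_add, Finset.sum_eq_zero (s := Finset.range h), zero_add]
  · refine Finset.sum_congr rfl fun j _ => ?_
    rw [if_neg (by omega)]
    congr 2
    omega
  · intro j hj
    have hj := Finset.mem_range.1 hj
    rw [entry, dif_pos (by omega), hy _ hj, zero_mul]

/-- The index `i` is recovered as the position of the first nonzero entry; `x` and `z` are then
slices of the column. -/
theorem headColumn_bijective (hkh : k ≤ h) (hhl : h ≤ l) :
    Function.Bijective
      fun s : (Σ p : Fin k × (Fin (l - h) → F), (Fin (h - 1 - p.1) → F)) =>
        (⟨headColumn l h s.1.1 s.1.2 s.2, isNormalized_headColumn hkh hhl _ _ _⟩ :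
          {y : Fin l → F // IsNormalized k y}) := by
  constructor
  · rintro ⟨⟨i, z⟩, x⟩ ⟨⟨i', z'⟩, x'⟩ heq
    have heq : headColumn l h i z x = headColumn l h i' z' x' := congrArg Subtype.val heq
    have hi := i.2
    have hi' := i'.2
    have hii : i = i' := by
      rcases lt_trichotomy (i : ℕ) i' with hlt | he | hlt
      · have := congrFun heq ⟨i, by omega⟩
        simp [headColumn, hlt] at this
      · exact Fin.ext he
      · have := congrFun heq ⟨i', by omega⟩
        simp [headColumn, hlt] at this
    subst hii
    have hz : z = z' := by
      funext j
      have hj := j.2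
      have := congrFun heq ⟨h + j, by omega⟩
      simp only [headColumn] at this
      rw [if_neg (by omega), if_neg (by omega), if_neg (by omega), if_neg (by omega),
        if_neg (by omega), if_neg (by omega), Nat.add_sub_cancel_left, entry_val, entry_val] at this
      exact this
    subst hz
    have hx : x = x' := by
      funext j
      have hj := j.2
      simp only at hj
      have := congrFun heq ⟨i + 1 + j, by omega⟩
      simp only [headColumn] at this
      rw [if_neg (by omega), if_neg (by omega), if_pos (by omega), if_neg (by omega),
        if_neg (by omega), if_pos (by omega),
        show (i : ℕ) + 1 + j - i - 1 = j by omega, entry_val, entry_val] at this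
      exact this
    rw [hx]
  · rintro ⟨y, i, hi, h1, h0⟩
    refine ⟨⟨⟨⟨i, hi⟩, slice y h _⟩, slice y (i + 1) _⟩, Subtype.ext (funext fun ρ => ?_)⟩
    have hρ := ρ.2
    simp only [headColumn]
    split_ifs with h2 h3 h4
    · exact (h0 ρ h2).symm
    · rw [show ρ = i from Fin.ext h3, h1]
    · rw [entry_slice _ _ (by omega), show (i : ℕ) + 1 + (ρ - i - 1) = ρ by omega,
        entry_val]
    · rw [entry_slice _ _ (by omega), show h + ((ρ : ℕ) - h) = ρ by omega, entry_val]

theorem tailColumn_bijective (hkh : k ≤ h) (hhl : h ≤ l) :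
    Function.Bijective
      fun s : {p : Fin h → F // IsNormalized k p} × (Fin (l - h) → F) =>
        (⟨tailColumn l h s.1.1 s.2, isNormalized_tailColumn hhl s.1.2 _⟩ :
          {y : Fin l → F // IsNormalized k y}) := by
  constructor
  · rintro ⟨⟨p, hp⟩, x⟩ ⟨⟨p', hp'⟩, x'⟩ heq
    have heq : tailColumn l h p x = tailColumn l h p' x' := congrArg Subtype.val heq
    have h1 : p = p' := by
      funext j
      have hj := j.2
      have := congrFun heq ⟨j, by omega⟩
      simpa [tailColumn, entry_val] using this
    have h2 : x = x' := by
      funext j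
      have hj := j.2
      have := congrFun heq ⟨h + j, by omega⟩
      simpa [tailColumn, entry_val] using this
    subst h1 h2
    rfl
  · rintro ⟨y, i, hi, h1, h0⟩
    refine ⟨⟨⟨slice y 0 h, ⟨i, by omega⟩, hi, ?_, fun j hj => ?_⟩, slice y h _⟩,
      Subtype.ext (funext fun ρ => ?_)⟩
    · simp [slice, entry_val, h1]
    · have := h0 ⟨j, by omega⟩ hj
      rw [slice, zero_add, entry, dif_pos (by omega), this]
    · have hρ := ρ.2
      simp only [tailColumn]
      split_ifs with h2
      · rw [entry_slice _ _ h2, zero_add, entry_val]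
      · rw [entry_slice _ _ (by omega), show h + ((ρ : ℕ) - h) = ρ by omega, entry_val]

variable [Fintype F] [DecidableEq F]

/-- Stated for arbitrary summands because it serves twice: with indicators of agreement for the
distances, and with the constant 1 for the total block length in the operation count. -/
theorem sum_headColumn {A : Type w} [AddCommMonoid A] (hkh : k ≤ h) (hhl : h ≤ l)
    (f : (Fin l → F) → A) :
    ∑ p : Fin k × (Fin (l - h) → F), ∑ x : Fin (h - 1 - p.1) → F,
      f (headColumn l h p.1 p.2 x) = ∑ y : {y : Fin l → F // IsNormalized k y}, f y := by
  rw [Finset.sum_sigma']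
  exact (headColumn_bijective hkh hhl).sum_comp
    fun y : {y : Fin l → F // IsNormalized k y} => f y

theorem sum_tailColumn {A : Type w} [AddCommMonoid A] (hkh : k ≤ h) (hhl : h ≤ l)
    (f : (Fin l → F) → A) :
    ∑ p : {p : Fin h → F // IsNormalized k p}, ∑ x : Fin (l - h) → F,
      f (tailColumn l h p.1 x) = ∑ y : {y : Fin l → F // IsNormalized k y}, f y := by
  rw [← Fintype.sum_prod_type']
  exact (tailColumn_bijective hkh hhl).sum_comp
    fun y : {y : Fin l → F // IsNormalized k y} => f y

theorem sum_pow_headColumn (hkh : k ≤ h) (hhl : h ≤ l) :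
    ∑ p : Fin k × (Fin (l - h) → F), Fintype.card F ^ (h - 1 - p.1) =
      Fintype.card {y : Fin l → F // IsNormalized k y} := by
  simpa using sum_headColumn (A := ℕ) hkh hhl fun _ : Fin l → F => 1

theorem card_mul_pow_tailColumn (hkh : k ≤ h) (hhl : h ≤ l) :
    Fintype.card {p : Fin h → F // IsNormalized k p} * Fintype.card F ^ (l - h) =
      Fintype.card {y : Fin l → F // IsNormalized k y} := by
  simpa using sum_tailColumn (A := ℕ) hkh hhl fun _ : Fin l → F => 1

end Columns

/-! ## Branch metrics -/

section Distances

variable {F : Type u} [DecidableEq F] {n : ℕ}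

theorem hammingDist_eq_sub {A : Type v} [DecidableEq A] (c r : Fin n → A) :
    (hammingDist c r : ℤ) = n - ∑ i, if c i = r i then 1 else 0 := by
  have h := Finset.card_filter_add_card_filter_not (s := Finset.univ) fun i => c i = r i
  rw [Finset.card_univ, Fintype.card_fin] at h
  have h' : ((Finset.univ.filter fun i => c i = r i).card : ℤ) + hammingDist c r = n := by
    exact_mod_cast h
  rw [Finset.sum_boole]
  linarith

theorem result_directDistance (c r : Fin n → F) :
    (directDistance Nat.cast c r : Prog F ℤ ℤ).result = hammingDist c r := by
  rw [hammingDist_eq_sub, directDistance]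
  simp only [Prog.result_bind, Prog.result_tabulate, Prog.result, Nat.cast_zero, Nat.cast_one,
    Prog.result_sum, Finset.sum_map_toList]
  have h : ∀ i, (bif decide (c i = r i) then (0 : ℤ) else 1) = 1 - if c i = r i then 1 else 0 :=
    fun i => by by_cases h : c i = r i <;> simp [h]
  rw [Finset.sum_congr rfl fun i _ => h i, Finset.sum_sub_distrib]
  simp

theorem ops_directDistance (c r : Fin n → F) :
    (directDistance Nat.cast c r : Prog F ℤ ℤ).ops = n + (n - 1) := by
  simp [directDistance, Prog.ops]

end Distances

section Metrics

variable {F : Type u} [Field F] [Fintype F] [DecidableEq F] {k δ n : ℕ}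

theorem isBranchMetric_directMetrics (M : Matrix (Fin (k + δ)) (Fin n) F) (N t : ℕ)
    (r : Fin n → F) :
    IsBranchMetric M N t r (directMetrics (Nat.cast : ℕ → ℤ) M N t r).result := by
  intro y hy
  simp [directMetrics, Prog.result, hy, result_directDistance]

theorem ops_directMetrics (M : Matrix (Fin (k + δ)) (Fin n) F) (N t : ℕ) (r : Fin n → F) :
    (directMetrics (Nat.cast : ℕ → ℤ) M N t r).ops =
      Fintype.card {y : Fin (k + δ) → F // IsBranch N t y} * (n + (n - 1)) := by
  simp [directMetrics, Prog.ops, ops_directDistance]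

/-- The distance of the label of a branch to the received word, in terms of columns. -/
theorem hammingDist_macDonald (col : Fin n ≃ MacDonaldColumn F k δ) (r : Fin n → F)
    (y : Fin (k + δ) → F) :
    (hammingDist (Matrix.vecMul y (macDonaldMatrix col)) r : ℤ) =
      n - ∑ v : MacDonaldColumn F k δ, if y ⬝ᵥ v.1 = symbolAt col r v.1 then 1 else 0 := by
  rw [hammingDist_eq_sub, ← Equiv.sum_comp col]
  congr 1
  refine Finset.sum_congr rfl fun c _ => ?_
  have h : symbolAt col r (col c).1 = r c := by
    rw [symbolAt, dif_pos (col c).2]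
    simp
  rw [h]
  rfl

theorem result_headDistances (col : Fin n ≃ MacDonaldColumn F k δ) (r : Fin n → F) {h : ℕ}
    (hkh : k ≤ h) (hh : h ≤ k + δ) {y : Fin (k + δ) → F}
    (hy : ∀ ρ : Fin (k + δ), h ≤ ρ → y ρ = 0) :
    (headDistances (Nat.cast : ℕ → ℤ) col r h).result y =
      hammingDist (Matrix.vecMul y (macDonaldMatrix col)) r := by
  rw [hammingDist_macDonald, ← sum_headColumn hkh hh
    fun v => if y ⬝ᵥ v = symbolAt col r v then (1 : ℤ) else 0]
  simp only [headDistances, Prog.result_bind, Prog.result_tabulate, Prog.result,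
    Nat.cast_zero, Prog.result_sum, Finset.sum_map_toList]
  congr 1
  refine Finset.sum_congr rfl fun p _ => ?_
  have hi := p.1.2
  rw [result_correlate, entry_slice _ _ (by omega), zero_add, slice_slice _ (by omega)]
  refine Finset.sum_congr rfl fun x _ => ?_
  rw [dotProduct_headColumn hkh hh _ _ _ hy]
  rfl

theorem result_tailDistances (col : Fin n ≃ MacDonaldColumn F k δ) (r : Fin n → F) {h : ℕ}
    (hkh : k ≤ h) (hh : h ≤ k + δ) {y : Fin (k + δ) → F}
    (hy : ∀ ρ : Fin (k + δ), (ρ : ℕ) < h → y ρ = 0) :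
    (tailDistances (Nat.cast : ℕ → ℤ) col r h).result y =
      hammingDist (Matrix.vecMul y (macDonaldMatrix col)) r := by
  rw [hammingDist_macDonald, ← sum_tailColumn hkh hh
    fun v => if y ⬝ᵥ v = symbolAt col r v then (1 : ℤ) else 0]
  simp only [tailDistances, Prog.result_bind, Prog.result_tabulate, Prog.result,
    Nat.cast_zero, Prog.result_sum, Finset.sum_map_toList]
  congr 1
  refine Finset.sum_congr rfl fun p _ => ?_
  rw [result_correlate]
  refine Finset.sum_congr rfl fun x _ => ?_
  rw [dotProduct_tailColumn hh _ _ hy, zero_add]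
  rfl

theorem isBranchMetric_fastMetrics (hk : 1 ≤ k) (col : Fin n ≃ MacDonaldColumn F k δ) {N t : ℕ}
    (h1 : 1 ≤ t) (hN : t ≤ N) (r : Fin n → F) :
    IsBranchMetric (macDonaldMatrix col) N t r (fastMetrics (Nat.cast : ℕ → ℤ) col N t r).result := by
  intro y hy
  have hlt := memory_mul_lt (δ := δ) hk
  have hmono : ∀ j, 1 ≤ j → j ≤ memory k δ → k ≤ j * k ∧ j * k ≤ k + δ := fun j h1 h2 =>
    ⟨Nat.le_mul_of_pos_left k h1, (Nat.mul_le_mul_right k h2).trans hlt.le⟩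
  unfold fastMetrics
  split_ifs with h2 h3
  · have := hmono t h1 h2
    exact result_headDistances col r this.1 this.2 fun ρ hρ => hy ρ (.inl hρ)
  · exact result_headDistances col r (by omega) le_rfl fun ρ hρ => absurd ρ.2 (by omega)
  · have := hmono (t + memory k δ - N) (by omega) (by omega)
    exact result_tailDistances col r this.1 this.2 fun ρ hρ => hy ρ (.inr hρ)

theorem card_macDonaldColumn (col : Fin n ≃ MacDonaldColumn F k δ) :
    Fintype.card (MacDonaldColumn F k δ) = n := by
  rw [← Fintype.card_congr col, Fintype.card_fin]

/-- With `h = k + δ` there is one block for each position of the leading one, and the block lengths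
form a geometric progression. -/
theorem length_eq_sum (col : Fin n ≃ MacDonaldColumn F k δ) :
    n = ∑ i ∈ Finset.range k, Fintype.card F ^ (δ + i) := by
  rw [← card_macDonaldColumn col,
    ← sum_pow_headColumn (F := F) (k := k) (l := k + δ) (h := k + δ) (by omega) le_rfl,
    ← Finset.univ_product_univ, Finset.sum_product, ← Finset.sum_range_reflect,
    ← Fin.sum_univ_eq_sum_range fun i => Fintype.card F ^ (δ + (k - 1 - i))]
  refine Finset.sum_congr rfl fun i _ => ?_
  have := i.2
  simp
  congr 1
  omega

theorem length_eq (col : Fin n ≃ MacDonaldColumn F k δ) :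
    n = Fintype.card F ^ δ * (Fintype.card F ^ k - 1) / (Fintype.card F - 1) := by
  have hq : 1 < Fintype.card F := Fintype.one_lt_card
  have h := Nat.geomSum_eq hq k
  have hd : (Fintype.card F - 1) ∣ (Fintype.card F ^ k - 1) := Nat.sub_one_dvd_pow_sub_one _ _
  rw [Nat.mul_div_assoc _ hd, ← h, Finset.mul_sum, length_eq_sum col]
  simp only [pow_add]

theorem pow_le_length (hk : 1 ≤ k) (col : Fin n ≃ MacDonaldColumn F k δ) :
    Fintype.card F ^ (k + δ - 1) ≤ n := by
  rw [length_eq_sum col, show k + δ - 1 = δ + (k - 1) by omega]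
  exact Finset.single_le_sum (f := fun i => Fintype.card F ^ (δ + i)) (fun _ _ => Nat.zero_le _)
    (Finset.mem_range.2 (by omega))

theorem pow_le_card_mul_length (hk : 1 ≤ k) (col : Fin n ≃ MacDonaldColumn F k δ) :
    Fintype.card F ^ (k + δ) ≤ Fintype.card F * n := by
  have h := Nat.mul_le_mul_left (Fintype.card F) (pow_le_length hk col)
  rwa [← pow_succ', show k + δ - 1 + 1 = k + δ by omega] at h

theorem sum_pow_lt {q : ℕ} (hq : 2 ≤ q) (a : ℕ) : ∑ i ∈ Finset.range a, q ^ i < q ^ a := by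
  exact Nat.geomSum_lt hq fun i hi => Finset.mem_range.1 hi

/-- Together with `pow_le_card_mul_length`, this makes the number of branches in a full time step
comparable to `q * n`, uniformly in `q`. -/
theorem card_mul_length_le (col : Fin n ≃ MacDonaldColumn F k δ) :
    Fintype.card F * n ≤ 2 * Fintype.card F ^ (k + δ) := by
  have hq : 2 ≤ Fintype.card F := Fintype.one_lt_card
  have h := sum_pow_lt hq k
  rw [length_eq_sum col, Finset.mul_sum]
  have h2 : ∑ i ∈ Finset.range k, Fintype.card F * Fintype.card F ^ (δ + i) =
      Fintype.card F ^ δ * ∑ i ∈ Finset.range k, Fintype.card F ^ (i + 1) := by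
    rw [Finset.mul_sum]
    exact Finset.sum_congr rfl fun i _ => by ring
  have h3 : ∑ i ∈ Finset.range k, Fintype.card F ^ (i + 1) ≤ 2 * Fintype.card F ^ k := by
    have := Finset.sum_range_succ' (fun i => Fintype.card F ^ i) k
    rw [Finset.sum_range_succ] at this
    omega
  rw [h2]
  calc _ ≤ Fintype.card F ^ δ * (2 * Fintype.card F ^ k) := Nat.mul_le_mul_left _ h3
    _ = _ := by ring

theorem ops_headDistances_le (hk : 1 ≤ k) (col : Fin n ≃ MacDonaldColumn F k δ) (r : Fin n → F)
    {h : ℕ} (hkh : k ≤ h) (hh : h ≤ k + δ) :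
    (headDistances (Nat.cast : ℕ → ℤ) col r h).ops ≤
      3 * (k + δ) * (Fintype.card F ^ 2 * n) := by
  set q := Fintype.card F with hqdef
  have hq : 2 ≤ q := Fintype.one_lt_card
  have hops : (headDistances (Nat.cast : ℕ → ℤ) col r h).ops =
      ∑ p : Fin k × (Fin (k + δ - h) → F),
        q ^ (h - 1 - p.1 + 1) * (1 + (h - 1 - p.1 : ℕ) * (q - 1)) +
      q ^ h * (k * q ^ (k + δ - h) - 1 + 1) := by
    simp [headDistances, Prog.ops, ops_correlate, ← hqdef]
  have h1 : ∑ p : Fin k × (Fin (k + δ - h) → F),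
        q ^ (h - 1 - p.1 + 1) * (1 + (h - 1 - p.1 : ℕ) * (q - 1)) ≤
      ∑ p : Fin k × (Fin (k + δ - h) → F), q ^ (h - 1 - p.1) * (q * ((k + δ) * q)) := by
    refine Finset.sum_le_sum fun p _ => ?_
    rw [pow_succ, mul_assoc]
    refine Nat.mul_le_mul_left _ (Nat.mul_le_mul_left _ ?_)
    have h2 : (h - 1 - p.1) * (q - 1) ≤ (k + δ - 1) * q :=
      Nat.mul_le_mul (by omega) (Nat.sub_le _ _)
    have h3 : (k + δ - 1) * q + q = (k + δ) * q := by
      rw [← Nat.succ_mul]; congr 1; omega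
    omega
  rw [← Finset.sum_mul, sum_pow_headColumn hkh hh, card_macDonaldColumn col] at h1
  -- There is at least one block, so the addition saved in each sum is offset exactly by the final
  -- subtraction from `n`.
  have h2 : 1 ≤ k * q ^ (k + δ - h) := Nat.mul_pos hk (Nat.pow_pos (by omega))
  have h3 : q ^ h * (k * q ^ (k + δ - h) - 1 + 1) = k * q ^ (k + δ) := by
    rw [Nat.sub_add_cancel h2, mul_left_comm, ← pow_add, Nat.add_sub_cancel' hh]
  have h4 : k * q ^ (k + δ) ≤ (k + δ) * (q ^ 2 * n) := by
    refine Nat.mul_le_mul (by omega) ((pow_le_card_mul_length hk col).trans ?_)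
    exact Nat.mul_le_mul_right _ (Nat.le_self_pow (by omega) _)
  rw [hops, h3]
  calc _ ≤ n * (q * ((k + δ) * q)) + (k + δ) * (q ^ 2 * n) := Nat.add_le_add h1 h4
    _ = 2 * (k + δ) * (q ^ 2 * n) := by ring
    _ ≤ _ := Nat.mul_le_mul_right _ (Nat.mul_le_mul_right _ (by omega))

theorem ops_tailDistances_le (hk : 1 ≤ k) (col : Fin n ≃ MacDonaldColumn F k δ) (r : Fin n → F)
    {h : ℕ} (hkh : k ≤ h) (hh : h ≤ k + δ) :
    (tailDistances (Nat.cast : ℕ → ℤ) col r h).ops ≤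
      3 * (k + δ) * (Fintype.card F ^ 2 * n) := by
  set q := Fintype.card F with hqdef
  have hq : 2 ≤ q := Fintype.one_lt_card
  set c := Fintype.card {p : Fin h → F // IsNormalized k p} with hc
  have hops : (tailDistances (Nat.cast : ℕ → ℤ) col r h).ops =
      c * (q ^ (k + δ - h + 1) * (1 + (k + δ - h) * (q - 1))) +
      q ^ (k + δ - h) * (c - 1 + 1) := by
    simp [tailDistances, Prog.ops, ops_correlate, ← hqdef, ← hc]
  have hcn : c * q ^ (k + δ - h) = n := by
    rw [hc, hqdef, card_mul_pow_tailColumn hkh hh, card_macDonaldColumn col]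
  have h1 : 1 + (k + δ - h) * (q - 1) ≤ (k + δ) * q := by
    have h2 : (k + δ - h) * (q - 1) ≤ (k + δ - 1) * q :=
      Nat.mul_le_mul (by omega) (Nat.sub_le _ _)
    have h3 : (k + δ - 1) * q + q = (k + δ) * q := by
      rw [← Nat.succ_mul]; congr 1; omega
    omega
  have h2 : q ^ (k + δ - h) ≤ q * n :=
    (Nat.pow_le_pow_right (by omega) (by omega)).trans (pow_le_card_mul_length hk col)
  have h3 : q ≤ (k + δ) * q ^ 2 :=
    (Nat.le_self_pow (by omega) _).trans (Nat.le_mul_of_pos_left _ (by omega))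
  -- The crude bound `c + 1` makes it unnecessary to know that there is a block; the excess is one
  -- operation per word.
  have h4 : q ^ (k + δ - h) * (c - 1 + 1) ≤ n + q * n := by
    calc _ ≤ q ^ (k + δ - h) * (c + 1) := Nat.mul_le_mul_left _ (by omega)
      _ = n + q ^ (k + δ - h) := by rw [← hcn]; ring
      _ ≤ _ := by omega
  rw [hops]
  calc _ ≤ c * (q ^ (k + δ - h + 1) * ((k + δ) * q)) + (n + q * n) :=
        Nat.add_le_add (Nat.mul_le_mul_left _ (Nat.mul_le_mul_left _ h1)) h4
    _ = c * q ^ (k + δ - h) * (q * ((k + δ) * q)) + (1 + q) * n := by ring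
    _ = n * ((k + δ) * q ^ 2) + (1 + q) * n := by rw [hcn]; ring
    _ ≤ n * ((k + δ) * q ^ 2) + (2 * ((k + δ) * q ^ 2)) * n :=
        Nat.add_le_add_left (Nat.mul_le_mul_right _ (by omega)) _
    _ = _ := by ring

theorem ops_fastMetrics_le (hk : 1 ≤ k) (col : Fin n ≃ MacDonaldColumn F k δ) {N t : ℕ}
    (h1 : 1 ≤ t) (hN : t ≤ N) (r : Fin n → F) :
    (fastMetrics (Nat.cast : ℕ → ℤ) col N t r).ops ≤
      3 * (k + δ) * (Fintype.card F ^ 2 * n) := by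
  have hlt := memory_mul_lt (δ := δ) hk
  have hmono : ∀ j, 1 ≤ j → j ≤ memory k δ → k ≤ j * k ∧ j * k ≤ k + δ := fun j h1 h2 =>
    ⟨Nat.le_mul_of_pos_left k h1, (Nat.mul_le_mul_right k h2).trans hlt.le⟩
  unfold fastMetrics
  split_ifs with h2 h3
  · have := hmono t h1 h2
    exact ops_headDistances_le hk col r this.1 this.2
  · exact ops_headDistances_le hk col r (by omega) le_rfl
  · have := hmono (t + memory k δ - N) (by omega) (by omega)
    exact ops_tailDistances_le hk col r this.1 this.2

end Metrics

/-! ## The number of branches -/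

section Branches

variable {F : Type u} [Field F] [Fintype F] [DecidableEq F] {k δ : ℕ}

theorem card_isBranch_le_pow {N t c : ℕ} (s : Finset (Fin (k + δ))) (hs : s.card ≤ c)
    (h : ∀ y : Fin (k + δ) → F, IsBranch N t y → ∀ ρ ∉ s, y ρ = 0) :
    Fintype.card {y : Fin (k + δ) → F // IsBranch N t y} ≤ Fintype.card F ^ c := by
  have hinj : Function.Injective fun (y : {y : Fin (k + δ) → F // IsBranch N t y}) (ρ : s) =>
      y.1 ρ := by
    intro y y' hyy
    ext ρ
    by_cases hρ : ρ ∈ s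
    · exact congrFun hyy ⟨ρ, hρ⟩
    · rw [h _ y.2 ρ hρ, h _ y'.2 ρ hρ]
  calc _ ≤ Fintype.card (s → F) := Fintype.card_le_of_injective _ hinj
    _ = Fintype.card F ^ s.card := by simp
    _ ≤ _ := Nat.pow_le_pow_right Fintype.card_pos hs

theorem card_isBranch_le (N t : ℕ) :
    Fintype.card {y : Fin (k + δ) → F // IsBranch N t y} ≤ Fintype.card F ^ (k + δ) :=
  card_isBranch_le_pow Finset.univ (by simp) (by simp)

theorem card_isBranch_eq (hk : 1 ≤ k) {N t : ℕ} (h1 : memory k δ < t) (h2 : t ≤ N - memory k δ) :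
    Fintype.card {y : Fin (k + δ) → F // IsBranch N t y} = Fintype.card F ^ (k + δ) := by
  have h : ∀ y : Fin (k + δ) → F, IsBranch N t y := by
    rintro y ρ (hρ | hρ)
    · have h3 := Nat.mul_le_mul_right k (Nat.succ_le_of_lt h1)
      rw [Nat.succ_mul] at h3
      have := le_memory_mul (δ := δ) hk
      omega
    · rw [show t + memory k δ - N = 0 by omega] at hρ
      omega
  rw [Fintype.card_subtype, Finset.filter_true_of_mem fun y _ => h y]
  simp

theorem card_isBranch_start_le (N t : ℕ) :
    Fintype.card {y : Fin (k + δ) → F // IsBranch N t y} ≤ Fintype.card F ^ (t * k) := by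
  refine card_isBranch_le_pow ({ρ | (ρ : ℕ) < t * k} : Finset (Fin (k + δ))) ?_ fun y hy ρ hρ =>
    hy ρ (.inl (by simpa using hρ))
  refine (Finset.card_map Fin.valEmbedding).symm.le.trans
    ((Finset.card_le_card (t := Finset.range (t * k)) fun x => ?_).trans (Finset.card_range _).le)
  simp only [Finset.mem_map, Finset.mem_filter, Finset.mem_univ, true_and, Finset.mem_range]
  rintro ⟨ρ, hρ, rfl⟩
  exact hρ

theorem card_isBranch_end_le (N t : ℕ) :
    Fintype.card {y : Fin (k + δ) → F // IsBranch N t y} ≤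
      Fintype.card F ^ (k + δ - (t + memory k δ - N) * k) := by
  refine card_isBranch_le_pow
    ({ρ | (t + memory k δ - N) * k ≤ (ρ : ℕ)} : Finset (Fin (k + δ))) ?_ fun y hy ρ hρ =>
    hy ρ (.inr (by simpa using hρ))
  rw [← Finset.card_map Fin.valEmbedding,
    ← Nat.card_Ico ((t + memory k δ - N) * k) (k + δ)]
  refine Finset.card_le_card fun x => ?_
  simp only [Finset.mem_map, Finset.mem_filter, Finset.mem_univ, true_and, Finset.mem_Ico]
  rintro ⟨ρ, hρ, rfl⟩
  exact ⟨hρ, ρ.2⟩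

theorem sum_card_isBranch_ge (hk : 1 ≤ k) (N : ℕ) :
    (N - 2 * memory k δ) * Fintype.card F ^ (k + δ) ≤
      ∑ t ∈ Finset.range N, Fintype.card {y : Fin (k + δ) → F // IsBranch N (t + 1) y} := by
  have hsub : Finset.Ico (memory k δ) (N - memory k δ) ⊆ Finset.range N := fun t => by
    simp; omega
  refine le_trans (le_of_eq ?_) (Finset.sum_le_sum_of_subset hsub)
  rw [Finset.sum_congr rfl (g := fun _ => Fintype.card F ^ (k + δ)), Finset.sum_const,
    Nat.card_Ico, smul_eq_mul]
  · congr 1; omega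
  · intro t ht
    have := Finset.mem_Ico.1 ht
    exact card_isBranch_eq hk (by omega) (by omega)

/-- In the start phase the exponents `k, 2 * k, …, μ * k` stay below `k + δ` and grow by at least
one per step, so the counts are dominated by a geometric series with sum at most `2 * q ^ (k + δ)`.
The end phase is symmetric, which gives the extra 4. -/
theorem sum_card_isBranch_le (hk : 1 ≤ k) {N : ℕ} (hN : 2 * memory k δ ≤ N) :
    ∑ t ∈ Finset.range N, Fintype.card {y : Fin (k + δ) → F // IsBranch N (t + 1) y} ≤
      (N - 2 * memory k δ + 4) * Fintype.card F ^ (k + δ) := by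
  have hq : 2 ≤ Fintype.card F := Fintype.one_lt_card
  have hlt := memory_mul_lt (δ := δ) hk
  obtain ⟨d, rfl⟩ : ∃ d, N = memory k δ + d + memory k δ := ⟨N - 2 * memory k δ, by omega⟩
  rw [Finset.sum_range_add, Finset.sum_range_add]
  have hpow : ∀ j, j < memory k δ → Fintype.card F ^ ((j + 1) * k) ≤
      Fintype.card F ^ (k + δ - memory k δ) * Fintype.card F ^ (j + 1) := fun j hj => by
    rw [← pow_add]
    refine Nat.pow_le_pow_right (by omega) ?_
    have h1 : (memory k δ - (j + 1)) * 1 ≤ (memory k δ - (j + 1)) * k := Nat.mul_le_mul_left _ hk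
    have h2 : (memory k δ - (j + 1)) * k + (j + 1) * k = memory k δ * k := by
      rw [← add_mul]; congr 1; omega
    omega
  have hmem : memory k δ ≤ k + δ := (Nat.le_mul_of_pos_right _ hk).trans hlt.le
  have hgeom : Fintype.card F ^ (k + δ - memory k δ) *
      ∑ j ∈ Finset.range (memory k δ), Fintype.card F ^ (j + 1) ≤
        2 * Fintype.card F ^ (k + δ) := by
    have h := sum_pow_lt hq (memory k δ)
    have := Finset.sum_range_succ' (fun i => Fintype.card F ^ i) (memory k δ)
    rw [Finset.sum_range_succ] at this
    calc _ ≤ Fintype.card F ^ (k + δ - memory k δ) * (2 * Fintype.card F ^ memory k δ) :=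
          Nat.mul_le_mul_left _ (by omega)
      _ = 2 * Fintype.card F ^ (k + δ - memory k δ + memory k δ) := by ring
      _ = _ := by rw [Nat.sub_add_cancel hmem]
  have h1 : ∑ t ∈ Finset.range (memory k δ), Fintype.card {y : Fin (k + δ) → F //
      IsBranch (memory k δ + d + memory k δ) (t + 1) y} ≤ 2 * Fintype.card F ^ (k + δ) := by
    refine le_trans (Finset.sum_le_sum fun t ht => ?_) ((Finset.mul_sum _ _ _).symm.trans_le hgeom)
    exact (card_isBranch_start_le _ _).trans (hpow t (Finset.mem_range.1 ht))
  have h2 : ∑ t ∈ Finset.range d, Fintype.card {y : Fin (k + δ) → F //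
      IsBranch (memory k δ + d + memory k δ) (memory k δ + t + 1) y} ≤
        d * Fintype.card F ^ (k + δ) := by
    refine (Finset.sum_le_card_nsmul _ _ _ fun t _ => card_isBranch_le _ _).trans ?_
    simp
  have h3 : ∑ t ∈ Finset.range (memory k δ), Fintype.card {y : Fin (k + δ) → F //
      IsBranch (memory k δ + d + memory k δ) (memory k δ + d + t + 1) y} ≤
        2 * Fintype.card F ^ (k + δ) := by
    -- Read backwards in time, the branch counts of the end phase increase and obey the same
    -- geometric bound.
    rw [← Finset.sum_range_reflect]
    refine le_trans (Finset.sum_le_sum fun t ht => ?_) ((Finset.mul_sum _ _ _).symm.trans_le hgeom)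
    have ht := Finset.mem_range.1 ht
    refine (card_isBranch_end_le _ _).trans ?_
    rw [← pow_add]
    refine Nat.pow_le_pow_right (by omega) ?_
    rw [show memory k δ + d + (memory k δ - 1 - t) + 1 + memory k δ -
      (memory k δ + d + memory k δ) = memory k δ - t by omega]
    have := Nat.mul_le_mul_left (memory k δ - t) hk
    omega
  calc _ ≤ 2 * Fintype.card F ^ (k + δ) + d * Fintype.card F ^ (k + δ) +
        2 * Fintype.card F ^ (k + δ) := by gcongr
    _ = (d + 4) * Fintype.card F ^ (k + δ) := by ring
    _ ≤ _ := Nat.mul_le_mul_right _ (by omega)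

end Branches

/-! ## Operation counts of the two algorithms -/

section Counts

variable {F : Type u} [Field F] [Fintype F] [DecidableEq F] {k δ n N : ℕ}

theorem ops_improvedViterbi_le (hk : 1 ≤ k) (col : Fin n ≃ MacDonaldColumn F k δ)
    (e : Fin (numLast k δ) ↪o Fin k) (coin : ℕ → (Fin (k + δ) → F) → Bool) (r : Fin n → F[X]) :
    (improvedViterbi (Nat.cast : ℕ → ℤ) col e N coin r).ops ≤
      N * (5 * (k + δ) * (Fintype.card F ^ 2 * n)) := by
  refine (ops_trellisSearch e N coin _ _).2.trans ?_
  refine (Finset.sum_le_card_nsmul _ _ (5 * (k + δ) * (Fintype.card F ^ 2 * n))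
    fun t ht => ?_).trans (by simp)
  have ht := Finset.mem_range.1 ht
  have h1 := ops_fastMetrics_le hk col (N := N) (t := t + 1) (by omega) (by omega)
    (coeffVec r (t + 1 - 1))
  have h2 : Fintype.card {y : Fin (k + δ) → F // IsBranch N (t + 1) y} ≤
      (k + δ) * (Fintype.card F ^ 2 * n) := by
    refine (card_isBranch_le N (t + 1)).trans ((pow_le_card_mul_length hk col).trans ?_)
    refine (Nat.mul_le_mul_right n (Nat.le_self_pow two_ne_zero (Fintype.card F))).trans ?_
    exact Nat.le_mul_of_pos_left _ (by omega)
  calc _ ≤ 3 * (k + δ) * (Fintype.card F ^ 2 * n) + 2 * ((k + δ) * (Fintype.card F ^ 2 * n)) :=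
        Nat.add_le_add h1 (Nat.mul_le_mul_left _ h2)
    _ = _ := by ring

theorem ops_generalViterbi_le (hk : 1 ≤ k) (col : Fin n ≃ MacDonaldColumn F k δ)
    (hN : 2 * memory k δ ≤ N) (e : Fin (numLast k δ) ↪o Fin k)
    (coin : ℕ → (Fin (k + δ) → F) → Bool) (r : Fin n → F[X]) :
    (generalViterbi (Nat.cast : ℕ → ℤ) (macDonaldMatrix col) e N coin r).ops ≤
      4 * ((N - 2 * memory k δ + 4) * Fintype.card F * n ^ 2) := by
  have hn : 1 ≤ n := (Nat.pow_pos Fintype.card_pos).trans_le (pow_le_length hk col)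
  refine (ops_trellisSearch e N coin _ _).2.trans ?_
  calc _ ≤ ∑ t ∈ Finset.range N,
          4 * n * Fintype.card {y : Fin (k + δ) → F // IsBranch N (t + 1) y} := by
        -- Per branch there are `2 * n - 1` operations for the distance and at most 2 in the trellis
        -- step, hence at most `4 * n` as `n ≥ 1`.
        refine Finset.sum_le_sum fun t _ => ?_
        rw [ops_directMetrics, mul_comm 2, ← mul_add, mul_comm (4 * n)]
        exact Nat.mul_le_mul_left _ (by omega)
    _ ≤ 4 * n * ((N - 2 * memory k δ + 4) * (Fintype.card F * n)) := by
        rw [← Finset.mul_sum]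
        exact Nat.mul_le_mul_left _ ((sum_card_isBranch_le hk hN).trans
          (Nat.mul_le_mul_left _ (pow_le_card_mul_length hk col)))
    _ = _ := by ring

theorem le_ops_generalViterbi (hk : 1 ≤ k) (col : Fin n ≃ MacDonaldColumn F k δ)
    (e : Fin (numLast k δ) ↪o Fin k) (coin : ℕ → (Fin (k + δ) → F) → Bool) (r : Fin n → F[X]) :
    (N - 2 * memory k δ) * Fintype.card F * n ^ 2 ≤
      2 * (generalViterbi (Nat.cast : ℕ → ℤ) (macDonaldMatrix col) e N coin r).ops := by
  refine le_trans ?_ (Nat.mul_le_mul_left 2 (ops_trellisSearch e N coin _ _).1)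
  calc (N - 2 * memory k δ) * Fintype.card F * n ^ 2
      = n * ((N - 2 * memory k δ) * (Fintype.card F * n)) := by ring
    _ ≤ n * ((N - 2 * memory k δ) * (2 * Fintype.card F ^ (k + δ))) :=
        Nat.mul_le_mul_left _ (Nat.mul_le_mul_left _ (card_mul_length_le col))
    _ = 2 * (n * ((N - 2 * memory k δ) * Fintype.card F ^ (k + δ))) := by ring
    _ ≤ 2 * (n * ∑ t ∈ Finset.range N,
          Fintype.card {y : Fin (k + δ) → F // IsBranch N (t + 1) y}) :=
        Nat.mul_le_mul_left _ (Nat.mul_le_mul_left _ (sum_card_isBranch_ge hk N))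
    _ ≤ _ := by
        refine Nat.mul_le_mul_left _ ?_
        rw [Finset.mul_sum]
        refine Finset.sum_le_sum fun t _ => ?_
        rw [ops_directMetrics, mul_comm n]
        exact Nat.mul_le_mul_left _ (by omega)

/-- The factor 2 absorbs the loss of one in the exponent, as `k + δ ≥ 2`. For `k = 1`, `δ = 0` one
would have `n = 1` and a vanishing logarithm. -/
theorem add_le_two_mul_logb (hk : 1 ≤ k) (hkδ : 2 ≤ k + δ) (col : Fin n ≃ MacDonaldColumn F k δ) :
    ((k + δ : ℕ) : ℝ) ≤ 2 * Real.logb (Fintype.card F) n := by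
  have hq : (1 : ℝ) < Fintype.card F := by exact_mod_cast Fintype.one_lt_card (α := F)
  have hn : 1 ≤ n := (Nat.pow_pos Fintype.card_pos).trans_le (pow_le_length hk col)
  have h : ((k + δ - 1 : ℕ) : ℝ) ≤ Real.logb (Fintype.card F) n := by
    rw [Real.le_logb_iff_rpow_le hq (by exact_mod_cast hn), Real.rpow_natCast]
    exact_mod_cast pow_le_length hk col
  have h2 : ((k + δ : ℕ) : ℝ) ≤ 2 * ((k + δ - 1 : ℕ) : ℝ) := by
    exact_mod_cast (by omega : k + δ ≤ 2 * (k + δ - 1))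
  linarith

end Counts

end Viterbi

/-! ### The main theorem: comparison of the constants -/

open Viterbi

theorem mainTheorem3 :
    ∃ A B₁ B₂ : ℝ, 0 < A ∧ 0 < B₁ ∧ 0 < B₂ ∧
      ∀ (F : Type*) [Field F] [Fintype F] [DecidableEq F] (q k δ n N : ℕ),
        Fintype.card F = q → 1 ≤ k → 2 ≤ k + δ → 2 * memory k δ + 1 ≤ N →
        ∀ (col : Fin n ≃ MacDonaldColumn F k δ) (e : Fin (numLast k δ) ↪o Fin k)
          (coin : ℕ → (Fin (k + δ) → F) → Bool) (r : Fin n → Polynomial F),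
          (∀ c, (r c).degree < (N : WithBot ℕ)) →
          n = q ^ δ * (q ^ k - 1) / (q - 1) ∧
          -- the improved algorithm decodes, within the stated number of operations
          IsNearestMessage (macDonaldMatrix col) e N r
            (improvedViterbi (fun i => (i : ℤ)) col e N coin r).result ∧
          ((improvedViterbi (fun i => (i : ℤ)) col e N coin r).ops : ℝ) ≤
            A * (N * q ^ 2 * n * Real.logb q n) ∧
          -- the general algorithm decodes too, with this number of operations up to constants
          IsNearestMessage (macDonaldMatrix col) e N r
            (generalViterbi (fun i => (i : ℤ)) (macDonaldMatrix col) e N coin r).result ∧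
          B₁ * (((N : ℝ) - 2 * memory k δ + 2) * q * n ^ 2) ≤
            (generalViterbi (fun i => (i : ℤ)) (macDonaldMatrix col) e N coin r).ops ∧
          ((generalViterbi (fun i => (i : ℤ)) (macDonaldMatrix col) e N coin r).ops : ℝ) ≤
            B₂ * (((N : ℝ) - 2 * memory k δ + 2) * q * n ^ 2) ∧
          -- in particular, for lengths of at least `3 μ`
          (3 * memory k δ ≤ N →
            B₁ * (N * q * n ^ 2) ≤
              (generalViterbi (fun i => (i : ℤ)) (macDonaldMatrix col) e N coin r).ops ∧
            ((generalViterbi (fun i => (i : ℤ)) (macDonaldMatrix col) e N coin r).ops : ℝ) ≤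
              B₂ * (N * q * n ^ 2)) := by
  -- Put `d = N - 2 * μ - 1`. The 10 is 5 times the 2 from the logarithm. The lower bound `(d + 1) /
  -- 2` is compared with `d + 3 ≤ 3 * (d + 1)`, which gives `1 / 6`. The upper bound `4 * (d + 5)`
  -- is at most `20 * (d + 1)`, which gives 20.
  refine ⟨10, 1 / 6, 20, by norm_num, by norm_num, by norm_num, ?_⟩
  intro F _ _ _ q k δ n N hq hk hkδ hN col e coin r _
  subst hq
  have hgen_le := ops_generalViterbi_le (N := N) hk col (by omega) e coin r
  have hgen_ge := le_ops_generalViterbi (N := N) hk col e coin r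
  have himp_le := ops_improvedViterbi_le (N := N) hk col e coin r
  have hlog := add_le_two_mul_logb hk hkδ col
  obtain ⟨d, hd⟩ : ∃ d, N = 2 * memory k δ + 1 + d := ⟨_, (Nat.add_sub_of_le hN).symm⟩
  have hdr : (N : ℝ) - 2 * memory k δ = d + 1 := by rw [hd]; push_cast; ring
  rw [show N - 2 * memory k δ = d + 1 by omega] at hgen_le hgen_ge
  set W : ℝ := (Fintype.card F : ℝ) * n ^ 2 with hW
  have hW0 : 0 ≤ W := by positivity
  have hd0 : (0 : ℝ) ≤ d := Nat.cast_nonneg d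
  have hgen_le' : ((generalViterbi (Nat.cast : ℕ → ℤ) (macDonaldMatrix col) e N coin r).ops : ℝ) ≤
      4 * ((d + 5) * W) := by
    have : ((generalViterbi (Nat.cast : ℕ → ℤ) (macDonaldMatrix col) e N coin r).ops : ℝ) ≤
      ((4 * ((d + 1 + 4) * Fintype.card F * n ^ 2) : ℕ) : ℝ) := by exact_mod_cast hgen_le
    push_cast at this
    linarith
  have hgen_ge' : (d + 1) * W ≤
      2 * ((generalViterbi (Nat.cast : ℕ → ℤ) (macDonaldMatrix col) e N coin r).ops : ℝ) := by
    have : (((d + 1) * Fintype.card F * n ^ 2 : ℕ) : ℝ) ≤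
      2 * ((generalViterbi (Nat.cast : ℕ → ℤ) (macDonaldMatrix col) e N coin r).ops : ℝ) := by
      exact_mod_cast hgen_ge
    push_cast at this
    linarith
  have hdW : 0 ≤ d * W := mul_nonneg hd0 hW0
  refine ⟨length_eq col, ?_, ?_, ?_, ?_, ?_, fun h3 => ⟨?_, ?_⟩⟩
  · exact isNearestMessage_trellisSearch hk _ e (by omega) coin r _ Nat.cast Nat.cast_zero
      fun t ht => isBranchMetric_fastMetrics hk col (by omega) (by omega) _
  · have h1 : ((improvedViterbi (Nat.cast : ℕ → ℤ) col e N coin r).ops : ℝ) ≤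
        ((N * (5 * (k + δ) * (Fintype.card F ^ 2 * n)) : ℕ) : ℝ) := by exact_mod_cast himp_le
    refine h1.trans ?_
    have h2 : (0 : ℝ) ≤ 5 * (N * (Fintype.card F : ℝ) ^ 2 * n) := by positivity
    have h3 := mul_le_mul_of_nonneg_left hlog h2
    push_cast at h3 ⊢
    linarith
  · exact isNearestMessage_trellisSearch hk _ e (by omega) coin r _ Nat.cast Nat.cast_zero
      fun t ht => isBranchMetric_directMetrics _ _ _ _
  · rw [hdr, mul_assoc, ← hW]
    refine le_of_mul_le_mul_left (hgen_ge'.trans' ?_) two_pos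
    nlinarith
  · rw [hdr, mul_assoc, ← hW]
    refine hgen_le'.trans ?_
    nlinarith
  -- The assumption `3 * μ ≤ N` amounts to `μ ≤ d + 1`, hence `N = 2 * μ + (d + 1) ≤ 3 * (d + 1)`.
  · have h4 : (N : ℝ) ≤ 3 * (d + 1) := by exact_mod_cast (by omega : N ≤ 3 * (d + 1))
    rw [mul_assoc, ← hW]
    refine le_of_mul_le_mul_left (hgen_ge'.trans' ?_) two_pos
    nlinarith [mul_le_mul_of_nonneg_right h4 hW0]
  · have h4 : (d : ℝ) + 1 ≤ N := by exact_mod_cast (by omega : d + 1 ≤ N)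
    rw [mul_assoc, ← hW]
    refine hgen_le'.trans ?_
    nlinarith [mul_le_mul_of_nonneg_right h4 hW0]
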